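/- Let $\Gamma\subset\mathbb R^d$ be a Delone set (uniformly discrete and relatively dense) and let $(B_n)_n$ be a van Hove sequence, i.e. a sequence of bounded Borel sets with $\mathrm{Vol}(B_n)>0$ such that $\mathrm{Vol}(\partial^K B_n)/\mathrm{Vol}(B_n)\to 0$ for every compact $K\subset\mathbb R^d$, where $\partial^K A=\big((A+K)\setminus A^\circ\big)\cup\big((\overline{\mathbb R^d\setminus A}-K)\cap A\big)$. Put $$\underline{\mathrm{dens}}(\Gamma)=\liminf_{n\to\infty}\inf_{x\in\mathbb R^d}\frac{\sharp(\Gamma\cap(x+B_n))}{\mathrm{Vol}(B_n)},\qquad \overline{\mathrm{dens}}(\Gamma)=\limsup_{n\to\infty}\sup_{x\in\mathbb R^d}\frac{\sharp(\Gamma\cap(x+B_n))}{\mathrm{Vol}(B_n)}.$$ Assume that the autocorrelation $\gamma$ of $\Gamma$ exists along $(B_n)_n$, i.e. that the measures $$\gamma_n=\frac{1}{\mathrm{Vol}(B_n)}\,\delta_{\Gamma\cap B_n}*\widetilde{\delta_{\Gamma\cap B_n}}=\frac{1}{\mathrm{Vol}(B_n)}\sum_{x,y\in\Gamma\cap B_n}\delta_{x-y}$$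 converge vaguely (tested against continuous compactly supported functions) to a locally finite measure $\gamma$. Then $\gamma$ is Fourier transformable with a positive Fourier transform: there is a locally finite positive measure $\widehat\gamma$ on $\mathbb R^d$ such that for every continuous compactly supported $f:\mathbb R^d\to\mathbb C$ the function $|\check f|^2$ is $\widehat\gamma$-integrable and $\int (f*\widetilde f)\,d\gamma=\int|\check f|^2\,d\widehat\gamma$, where $\widetilde f(x)=\overline{f(-x)}$ and $\check f(\xi)=\int f(x)e^{2\pi i x\cdot\xi}\,dx$. Moreover, every such $\widehat\gamma$ satisfies $$\big(\underline{\mathrm{dens}}(\Gamma)\big)^2\le\widehat\gamma(\{0\})\le\big(\overline{\mathrm{dens}}(\Gamma)\big)^2 .$$ -/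

import Mathlib

open MeasureTheory Filter Topology
open scoped ENNReal Pointwise FourierTransform Convolution ComplexConjugate

noncomputable section

/-- The van Hove boundary `∂^K A = ((A + K) \ A°) ∪ ((closure (ℝᵈ \ A) - K) ∩ A)`. -/
def vanHoveBoundary {d : ℕ} (K A : Set (EuclideanSpace ℝ (Fin d))) :
    Set (EuclideanSpace ℝ (Fin d)) :=
  ((A + K) \ interior A) ∪ ((closure Aᶜ - K) ∩ A)

/-- A van Hove sequence in `ℝᵈ`: bounded Borel sets of positive volume whose `K`-boundary is
asymptotically negligible compared with their volume, for every compact `K`.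
(Neither monotonicity nor exhaustion of `ℝᵈ` is required.) -/
structure IsVanHove {d : ℕ} (B : ℕ → Set (EuclideanSpace ℝ (Fin d))) : Prop where
  measurableSet : ∀ n, MeasurableSet (B n)
  isBounded : ∀ n, Bornology.IsBounded (B n)
  volume_pos : ∀ n, 0 < volume (B n)
  tendsto_boundary : ∀ K : Set (EuclideanSpace ℝ (Fin d)), IsCompact K →
    Tendsto (fun n => volume (vanHoveBoundary K (B n)) / volume (B n)) atTop (𝓝 0)

/-- The Dirac comb `δ_Γ = ∑_{x ∈ Γ} δ_x`. -/
def diracComb {d : ℕ} (Γ : Set (EuclideanSpace ℝ (Fin d))) :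
    Measure (EuclideanSpace ℝ (Fin d)) :=
  Measure.sum fun x : Γ => Measure.dirac (x : EuclideanSpace ℝ (Fin d))

/-- The finite-volume autocorrelation `(ω|_A * (ω|_A)~) / Vol(A)` of a positive measure `ω`.
For a positive measure, `ω~` is the image of `ω` under `x ↦ -x`. -/
def autocorrApprox {d : ℕ} (ω : Measure (EuclideanSpace ℝ (Fin d)))
    (A : Set (EuclideanSpace ℝ (Fin d))) : Measure (EuclideanSpace ℝ (Fin d)) :=
  (volume A)⁻¹ • Measure.conv (ω.restrict A) ((ω.restrict A).map fun x => -x)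

/-- `γ` is the autocorrelation of `ω` along `B`: it is a locally finite measure, and the
finite-volume autocorrelations of `ω` converge to it vaguely. -/
structure IsAutocorrelation {d : ℕ} (ω : Measure (EuclideanSpace ℝ (Fin d)))
    (B : ℕ → Set (EuclideanSpace ℝ (Fin d))) (γ : Measure (EuclideanSpace ℝ (Fin d))) :
    Prop where
  isLocallyFinite : IsLocallyFiniteMeasure γ
  tendsto_integral : ∀ f : EuclideanSpace ℝ (Fin d) → ℂ, Continuous f → HasCompactSupport f →
    Tendsto (fun n => ∫ x, f x ∂(autocorrApprox ω (B n))) atTop (𝓝 (∫ x, f x ∂γ))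

/-- `μ` is the Fourier transform of the measure `γ` (both positive): for every continuous
compactly supported `f`, the function `|f^∨|²` is `μ`-integrable and
`∫ (f * f~) dγ = ∫ |f^∨|² dμ`, where `f~(x)` is the complex conjugate of `f(-x)` and
`f^∨(ξ) = ∫ f(x) exp(2πi x·ξ) dx`. -/
structure IsFourierTransform {d : ℕ} (γ μ : Measure (EuclideanSpace ℝ (Fin d))) : Prop where
  isLocallyFinite : IsLocallyFiniteMeasure μ
  integrable : ∀ f : EuclideanSpace ℝ (Fin d) → ℂ, Continuous f → HasCompactSupport f →
    Integrable (fun ξ => ‖𝓕⁻ f ξ‖ ^ 2) μ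
  integral_eq : ∀ f : EuclideanSpace ℝ (Fin d) → ℂ, Continuous f → HasCompactSupport f →
    ∫ x, (f ⋆[ContinuousLinearMap.mul ℂ ℂ] fun y => conj (f (-y))) x ∂γ
      = ((∫ ξ, ‖𝓕⁻ f ξ‖ ^ 2 ∂μ : ℝ) : ℂ)

/-- The lower density `liminf_n inf_x #(Γ ∩ (x + B_n)) / Vol(B_n)`. -/
def lowerDensity {d : ℕ} (Γ : Set (EuclideanSpace ℝ (Fin d)))
    (B : ℕ → Set (EuclideanSpace ℝ (Fin d))) : ℝ≥0∞ :=
  liminf (fun n => ⨅ x : EuclideanSpace ℝ (Fin d),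
    ((Γ ∩ (x +ᵥ B n)).encard : ℝ≥0∞) / volume (B n)) atTop

/-- The upper density `limsup_n sup_x #(Γ ∩ (x + B_n)) / Vol(B_n)`. -/
def upperDensity {d : ℕ} (Γ : Set (EuclideanSpace ℝ (Fin d)))
    (B : ℕ → Set (EuclideanSpace ℝ (Fin d))) : ℝ≥0∞ :=
  limsup (fun n => ⨆ x : EuclideanSpace ℝ (Fin d),
    ((Γ ∩ (x +ᵥ B n)).encard : ℝ≥0∞) / volume (B n)) atTop

end

/-! Write `f~` for the reflected conjugate of `f` and `f^∨` for its inverse Fourier transform.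

Existence. For a finite set `S`, the sum of `(f * f~)(x - y)` over `x, y ∈ S` equals `∫ |∑ f(x -
t)|² dt`. By Plancherel this is the integral of `|f^∨|²` against `|∑ exp(-2πi x·ξ)|² dξ`. Hence each
finite-volume autocorrelation `γ_n` has a positive Fourier transform `μ_n`. Since `|f^∨|²` can be
made at least `1` on any given ball, the `μ_n` are bounded on compact sets and have a vague limit
along an ultrafilter. No mass of `|f^∨|² μ_n` escapes to infinity. Indeed, for a narrow mollifier
`u`, the function `g = u * f - f` is uniformly small with support in a fixed ball, so `∫ |g^∨|² dμ_n
= ∫ g * g~ dγ_n` is small uniformly in `n`. But `g^∨ = (u^∨ - 1) f^∨`, and `u^∨` vanishes at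
infinity, so `|f^∨| ≤ 2|g^∨|` far out (`exists_integral_le_integral_cutoff_add`). The identity
therefore survives the limit.

Density bounds. Test with `f_k = u * 1_{B_k} / Vol(B_k)`. By the van Hove property `|f_k^∨|²` tends
pointwise to the indicator of `{0}`, dominated by the integrable function `|u^∨|²`, so `∫ |f_k^∨|²
dγ^` tends to `γ^({0})` (`tendsto_lintegral_fourierInv_smoothedIndicator`). For fixed `k` the same
integral is the limit in `n` of `Vol(B_n)⁻¹ ∫ |∑_{x ∈ Γ ∩ B_n} f_k(x - t)|² dt`. The inner sum is an
average of normalized point counts in translates of `B_k`. Up to a boundary term that is negligible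
as `n → ∞`, this traps the integral between the squares of the infimum and the supremum of those
counts (`lintegral_fourierInv_smoothedIndicator_bounds`). Letting `k → ∞` gives both inequalities.
-/

/-! ### Self-correlation and Plancherel's theorem for continuous compactly supported functions -/

section Fourier

set_option linter.unusedSectionVars false

variable {V : Type*} [NormedAddCommGroup V] [InnerProductSpace ℝ V] [FiniteDimensional ℝ V]
  [MeasurableSpace V] [BorelSpace V]

/-- The convolution `f * f~`, where `f~(x)` is the complex conjugate of `f(-x)`. -/
noncomputable def selfCorr (f : V → ℂ) : V → ℂ := f ⋆[ContinuousLinearMap.mul ℂ ℂ] fun y =>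
    conj (f (-y))

lemma selfCorr_apply (f : V → ℂ) (x : V) : selfCorr f x = ∫ t, f t * conj (f (t - x)) := by
  simp [selfCorr, convolution_def]

lemma fourier_conj_neg (f : V → ℂ) (ξ : V) :
    𝓕 (fun y => conj (f (-y))) ξ = conj (𝓕 f ξ) := by
  rw [Real.fourier_eq', Real.fourier_eq', ← integral_conj,
    ← integral_neg_eq_self (fun v => Complex.exp _ • conj (f (-v)))]
  congr 1
  ext v
  simp [← Complex.exp_conj, Complex.conj_ofNat]

lemma integrable_conj_neg {f : V → ℂ} (hf : Integrable f) :
    Integrable (fun y => conj (f (-y))) :=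
  (Complex.conjLIE.integrable_comp_iff).2 hf.comp_neg

lemma continuous_conj_neg {f : V → ℂ} (hf : Continuous f) : Continuous (fun y => conj (f (-y))) :=
  Complex.continuous_conj.comp (hf.comp continuous_neg)

lemma hasCompactSupport_conj_neg {f : V → ℂ} (hf : HasCompactSupport f) :
    HasCompactSupport (fun y => conj (f (-y))) :=
  (hf.comp_homeomorph (Homeomorph.neg V)).comp_left (g := conj) (map_zero _)

lemma fourier_selfCorr {f : V → ℂ} (hf : Integrable f) (ξ : V) :
    𝓕 (selfCorr f) ξ = ((‖𝓕 f ξ‖ ^ 2 : ℝ) : ℂ) := by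
  rw [selfCorr, Real.fourier_mul_convolution_eq hf (integrable_conj_neg hf), fourier_conj_neg,
    Complex.mul_conj, Complex.normSq_eq_norm_sq]

lemma continuous_selfCorr {f : V → ℂ} (hf : Continuous f) (hc : HasCompactSupport f) :
    Continuous (selfCorr f) :=
  HasCompactSupport.continuous_convolution_left _ hc hf
    (continuous_conj_neg hf).locallyIntegrable

lemma hasCompactSupport_selfCorr {f : V → ℂ} (hc : HasCompactSupport f) :
    HasCompactSupport (selfCorr f) :=
  HasCompactSupport.convolution _ hc (hasCompactSupport_conj_neg hc)

lemma selfCorr_zero (f : V → ℂ) : selfCorr f 0 = ((∫ t, ‖f t‖ ^ 2 : ℝ) : ℂ) := by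
  rw [selfCorr_apply, ← integral_complex_ofReal]
  simp [Complex.mul_conj, Complex.normSq_eq_norm_sq]

/-- Moving the Fourier transform from `h` onto the Gaussian turns the integral into an average of
`h` against an approximate identity at `0`. Integrability of `𝓕 h` is not needed, which is what
allows it to be deduced afterwards. -/
lemma tendsto_integral_gaussian_smul_fourier {h : V → ℂ} (hf : Integrable h)
    (hc : ContinuousAt h 0) :
    Tendsto (fun c : ℝ => ∫ w : V, Complex.exp (-(c : ℂ)⁻¹ * ‖w‖ ^ 2) • 𝓕 h w) atTop (𝓝 (h 0)) := by
  refine (Real.tendsto_integral_gaussian_smul' hf hc).congr' ?_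
  filter_upwards [Ioi_mem_atTop 0] with c (hc : 0 < c)
  have J : Integrable (fun w : V ↦ Complex.exp (- (c : ℂ)⁻¹ * ‖w‖ ^ 2 +
      2 * Real.pi * Complex.I * inner ℝ (0 : V) w)) :=
    GaussianFourier.integrable_cexp_neg_mul_sq_norm_add
      (by rw [← Complex.ofReal_inv]; simpa) _ _
  have key : ∫ w : V, 𝓕 (fun w ↦ Complex.exp (- (c : ℂ)⁻¹ * ‖w‖ ^ 2 +
      2 * Real.pi * Complex.I * inner ℝ (0 : V) w)) w • h w =
      ∫ w : V, Complex.exp (- (c : ℂ)⁻¹ * ‖w‖ ^ 2 +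
      2 * Real.pi * Complex.I * inner ℝ (0 : V) w) • 𝓕 h w := by
    simpa using! (VectorFourier.integral_fourierIntegral_smul_eq_flip (L := innerₗ V)
      Real.continuous_fourierChar continuous_inner J hf)
  have hr : ∀ w : V, Complex.exp (- (c : ℂ)⁻¹ * ‖w‖ ^ 2) = Complex.exp (- (c : ℂ)⁻¹ * ‖w‖ ^ 2 +
      2 * Real.pi * Complex.I * inner ℝ (0 : V) w) := fun w => by simp
  simp_rw [hr]
  rw [← key]
  congr with w
  rw [fourier_gaussian_innerProductSpace' (by rw [← Complex.ofReal_inv]; simpa)]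
  congr 3
  · simp
  · rw [div_inv_eq_mul]; ring

/-- A continuous integrable function with nonnegative Fourier transform has an integrable Fourier
transform. -/
lemma integrable_of_fourier_eq_ofReal {h : V → ℂ} (hf : Integrable h) (hc : ContinuousAt h 0)
    {p : V → ℝ} (hp : ∀ ξ, 0 ≤ p ξ) (hpc : Continuous p) (hph : ∀ ξ, 𝓕 h ξ = (p ξ : ℂ)) :
    Integrable p := by
  have h1 := (tendsto_integral_gaussian_smul_fourier hf hc).norm
  have h2 : ∀ c : ℝ, ‖∫ w : V, Complex.exp (-(c : ℂ)⁻¹ * ‖w‖ ^ 2) • 𝓕 h w‖ =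
      ∫ w : V, Real.exp (-c⁻¹ * ‖w‖ ^ 2) * p w := by
    intro c
    have : ∀ w : V, Complex.exp (-(c : ℂ)⁻¹ * ‖w‖ ^ 2) • 𝓕 h w =
        ((Real.exp (-c⁻¹ * ‖w‖ ^ 2) * p w : ℝ) : ℂ) := fun w => by
      rw [hph, smul_eq_mul]; push_cast; rfl
    rw [integral_congr_ae (Eventually.of_forall this), integral_complex_ofReal, Complex.norm_real, Real.norm_of_nonneg]
    exact integral_nonneg fun w => mul_nonneg (Real.exp_pos _).le (hp w)
  replace h1 := h1.congr h2
  have hbd : ∃ C, ∀ ξ, p ξ ≤ C := by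
    refine ⟨∫ v, ‖h v‖, fun ξ => ?_⟩
    have := VectorFourier.norm_fourierIntegral_le_integral_norm Real.fourierChar volume
      (innerₗ V) h ξ
    calc p ξ = ‖𝓕 h ξ‖ := by rw [hph, Complex.norm_real, Real.norm_of_nonneg (hp ξ)]
      _ ≤ _ := this
  obtain ⟨C, hC⟩ := hbd
  have hint : ∀ c : ℝ, 0 < c → Integrable (fun w : V => Real.exp (-c⁻¹ * ‖w‖ ^ 2) * p w) := by
    intro c hc
    have hg : Integrable (fun w : V => Real.exp (-c⁻¹ * ‖w‖ ^ 2)) := by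
      have := (GaussianFourier.integrable_cexp_neg_mul_sq_norm_add (V := V) (b := (c : ℂ)⁻¹)
        (by rw [← Complex.ofReal_inv]; simpa) 0 0).norm
      refine this.congr (Eventually.of_forall fun w => ?_)
      simp only [Complex.norm_exp]
      congr 1
      rw [← Complex.ofReal_inv]
      simp only [zero_mul, add_zero]
      norm_cast
    refine hg.mul_bdd (c := C) hpc.aestronglyMeasurable (Eventually.of_forall fun w => ?_)
    rw [Real.norm_of_nonneg (hp w)]; exact hC w
  have hlim : Tendsto (fun n : ℕ => ∫⁻ w : V, ENNReal.ofReal (Real.exp (-((n : ℝ) + 1)⁻¹ * ‖w‖ ^ 2) * p w))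
      atTop (𝓝 (ENNReal.ofReal ‖h 0‖)) := by
    have h3 : Tendsto (fun n : ℕ => (n : ℝ) + 1) atTop atTop :=
      tendsto_atTop_add_const_right _ _ tendsto_natCast_atTop_atTop
    refine (ENNReal.tendsto_ofReal (h1.comp h3)).congr fun n => ?_
    simp only [Function.comp]
    rw [ofReal_integral_eq_lintegral_ofReal (hint _ (by positivity))]
    exact Eventually.of_forall fun w => mul_nonneg (Real.exp_pos _).le (hp w)
  -- The Gaussian means of `p` converge to `‖h 0‖`. As `p ≥ 0`, Fatou's lemma bounds `∫ p` by that
  -- limit.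
  have hfatou := lintegral_liminf_le (μ := (volume : Measure V)) (u := (atTop : Filter ℕ))
    (f := fun (n : ℕ) w => ENNReal.ofReal (Real.exp (-((n : ℝ) + 1)⁻¹ * ‖w‖ ^ 2) * p w))
    (fun n => by
      have := hpc.measurable
      fun_prop)
  rw [hlim.liminf_eq] at hfatou
  have hpt : ∀ w : V, liminf (fun n : ℕ =>
      ENNReal.ofReal (Real.exp (-((n : ℝ) + 1)⁻¹ * ‖w‖ ^ 2) * p w)) atTop = ENNReal.ofReal (p w) := by
    intro w
    refine Tendsto.liminf_eq (ENNReal.tendsto_ofReal ?_)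
    have h4 : Tendsto (fun n : ℕ => ((n : ℝ) + 1)⁻¹) atTop (𝓝 0) := by
      simpa using tendsto_one_div_add_atTop_nhds_zero_nat (𝕜 := ℝ)
    have := ((Real.continuous_exp.tendsto _).comp ((h4.neg).mul_const (‖w‖ ^ 2))).mul_const (p w)
    simpa using this
  simp_rw [hpt] at hfatou
  refine ⟨hpc.aestronglyMeasurable, ?_⟩
  rw [hasFiniteIntegral_iff_ofReal (Eventually.of_forall hp)]
  exact hfatou.trans_lt ENNReal.ofReal_lt_top

lemma continuous_fourier {f : V → ℂ} (hf : Integrable f) : Continuous (𝓕 f) :=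
  VectorFourier.fourierIntegral_continuous Real.continuous_fourierChar continuous_inner hf

lemma continuous_fourierInv {f : V → ℂ} (hf : Integrable f) : Continuous (𝓕⁻ f) := by
  have : 𝓕⁻ f = fun ξ => 𝓕 f (-ξ) := funext fun ξ => Real.fourierInv_eq_fourier_neg f ξ
  rw [this]
  exact (continuous_fourier hf).comp continuous_neg

/-- Plancherel's theorem for continuous compactly supported functions. -/
lemma plancherel_of_hasCompactSupport {f : V → ℂ} (hf : Continuous f) (hc : HasCompactSupport f) :
    Integrable (fun ξ => ‖𝓕 f ξ‖ ^ 2) ∧ ∫ ξ, ‖𝓕 f ξ‖ ^ 2 = ∫ t, ‖f t‖ ^ 2 := by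
  have hfi : Integrable f := hf.integrable_of_hasCompactSupport hc
  have hh := continuous_selfCorr hf hc
  have hhi : Integrable (selfCorr f) :=
      hh.integrable_of_hasCompactSupport (hasCompactSupport_selfCorr hc)
  have hint : Integrable (fun ξ => ‖𝓕 f ξ‖ ^ 2) :=
    integrable_of_fourier_eq_ofReal hhi hh.continuousAt (fun ξ => by positivity)
      ((continuous_fourier hfi).norm.pow 2) (fourier_selfCorr hfi)
  refine ⟨hint, ?_⟩
  have hF : 𝓕 (selfCorr f) = fun ξ => ((‖𝓕 f ξ‖ ^ 2 : ℝ) : ℂ) := funext (fourier_selfCorr hfi)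
  -- Plancherel is Fourier inversion for `f * f~` evaluated at `0`.
  have h0 := hhi.fourierInv_fourier_eq (by rw [hF]; exact hint.ofReal)
    (hh.continuousAt (x := 0))
  rw [hF, selfCorr_zero, Real.fourierInv_eq] at h0
  simp only [inner_zero_right, AddChar.map_zero_eq_one, one_smul] at h0
  rw [integral_complex_ofReal] at h0
  exact_mod_cast h0

lemma selfCorr_eq_zero {g : V → ℂ} {r : ℝ} (hg : ∀ x, r < ‖x‖ → g x = 0) {x : V}
    (hx : 2 * r < ‖x‖) : selfCorr g x = 0 := by
  rw [selfCorr_apply]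
  refine integral_eq_zero_of_ae (Eventually.of_forall fun t => ?_)
  by_cases ht : r < ‖t‖
  · simp [hg t ht]
  · have : r < ‖t - x‖ := by
      have := norm_sub_norm_le x t
      rw [norm_sub_rev] at this
      linarith
    simp [hg _ this]

lemma norm_selfCorr_le {g : V → ℂ} {r η : ℝ} (hη : 0 ≤ η) (hg : ∀ x, r < ‖x‖ → g x = 0)
    (hb : ∀ x, ‖g x‖ ≤ η) (x : V) :
    ‖selfCorr g x‖ ≤ η ^ 2 * volume.real (Metric.closedBall (0 : V) r) := by
  have h1 : selfCorr g x = ∫ t in Metric.closedBall (0 : V) r, g t * conj (g (t - x)) := by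
    rw [selfCorr_apply, setIntegral_eq_integral_of_forall_compl_eq_zero]
    intro t ht
    simp only [Metric.mem_closedBall, dist_zero_right, not_le] at ht
    simp [hg t ht]
  rw [h1]
  refine norm_setIntegral_le_of_norm_le_const measure_closedBall_lt_top fun t _ => ?_
  rw [norm_mul, RCLike.norm_conj, sq]
  exact mul_le_mul (hb _) (hb _) (norm_nonneg _) hη

end Fourier

/-! ### Finite-volume autocorrelations and their Fourier transforms -/

section FiniteAutocorrelation

/-- Finitely many balls of the packing radius cover `A`, and each contains at most one point of `Γ`.
-/
lemma deloneSet_inter_finite {X : Type*} [MetricSpace X] [ProperSpace X]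
    (Γ : Delone.DeloneSet X) {A : Set X} (hA : Bornology.IsBounded A) :
    (Γ.carrier ∩ A).Finite := by
  obtain ⟨r, hr, hΓ⟩ := Γ.subset_ball_singleton
  obtain ⟨t, ht, hAt⟩ := Metric.totallyBounded_iff.1
    (hA.isCompact_closure.totallyBounded.subset subset_closure) r hr
  refine (ht.biUnion (t := fun y => Γ.carrier ∩ Metric.ball y r) fun y _ => ?_).subset ?_
  · exact Set.Subsingleton.finite fun a ha b hb => hΓ ha.1 hb.1 ha.2 hb.2
  · rintro x ⟨hx, hxA⟩
    obtain ⟨y, hy, hxy⟩ := Set.mem_iUnion₂.1 (hAt hxA)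
    exact Set.mem_iUnion₂.2 ⟨y, hy, hx, hxy⟩

variable {d : ℕ}

lemma diracComb_restrict {Γ A : Set (EuclideanSpace ℝ (Fin d))} (hA : MeasurableSet A)
    {S : Finset (EuclideanSpace ℝ (Fin d))}
    (hS : ∀ x, x ∈ S ↔ x ∈ Γ ∩ A) :
    (diracComb Γ).restrict A = ∑ x ∈ S, Measure.dirac x := by
  ext s hs
  rw [Measure.restrict_apply hs, diracComb, Measure.sum_apply _ (hs.inter hA),
    Measure.finsetSum_apply]
  simp_rw [Measure.dirac_apply' _ (hs.inter hA), Measure.dirac_apply' _ hs]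
  rw [tsum_subtype Γ (fun x => (s ∩ A).indicator (1 : EuclideanSpace ℝ (Fin d) → ℝ≥0∞) x), tsum_eq_sum (s := S)]
  · refine Finset.sum_congr rfl fun x hx => ?_
    obtain ⟨h1, h2⟩ := (hS x).1 hx
    rw [Set.indicator_of_mem h1]
    by_cases hxs : x ∈ s
    · rw [Set.indicator_of_mem (show x ∈ s ∩ A from ⟨hxs, h2⟩), Set.indicator_of_mem hxs]
    · rw [Set.indicator_of_notMem (show x ∉ s ∩ A from fun h => hxs h.1), Set.indicator_of_notMem hxs]
  · intro x hx
    by_cases hΓ : x ∈ Γ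
    · rw [Set.indicator_of_mem hΓ, Set.indicator_of_notMem
        (show x ∉ s ∩ A from fun h => hx ((hS x).2 ⟨hΓ, h.2⟩))]
    · exact Set.indicator_of_notMem hΓ _

lemma autocorrApprox_diracComb {Γ A : Set (EuclideanSpace ℝ (Fin d))} (hA : MeasurableSet A)
    {S : Finset (EuclideanSpace ℝ (Fin d))}
    (hS : ∀ x, x ∈ S ↔ x ∈ Γ ∩ A) :
    autocorrApprox (diracComb Γ) A =
      (volume A)⁻¹ • ∑ x ∈ S, ∑ y ∈ S, Measure.dirac (x - y) := by
  rw [autocorrApprox, diracComb_restrict hA hS]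
  congr 1
  refine Measure.ext_of_lintegral _ fun f hf => ?_
  rw [Measure.lintegral_conv hf, lintegral_finsetSum_measure, lintegral_finsetSum_measure]
  refine Finset.sum_congr rfl fun x _ => ?_
  rw [lintegral_dirac, lintegral_map (by fun_prop) (by fun_prop), lintegral_finsetSum_measure,
    lintegral_finsetSum_measure]
  simp [sub_eq_add_neg]

lemma integral_autocorrApprox_diracComb {Γ A : Set (EuclideanSpace ℝ (Fin d))}
    (hA : MeasurableSet A) {S : Finset (EuclideanSpace ℝ (Fin d))}
    (hS : ∀ x, x ∈ S ↔ x ∈ Γ ∩ A) (f : EuclideanSpace ℝ (Fin d) → ℂ) :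
    ∫ x, f x ∂(autocorrApprox (diracComb Γ) A) =
      (((volume.real A)⁻¹ : ℝ) : ℂ) * ∑ x ∈ S, ∑ y ∈ S, f (x - y) := by
  have hi : ∀ z : EuclideanSpace ℝ (Fin d), Integrable f (Measure.dirac z) := fun z =>
      integrable_dirac (by simp)
  rw [autocorrApprox_diracComb hA hS, integral_smul_measure,
    integral_finsetSum_measure fun x _ => integrable_finsetSum_measure.2 fun y _ => hi _]
  simp_rw [integral_finsetSum_measure fun y _ => hi _, integral_dirac]
  rw [ENNReal.toReal_inv]
  simp [Measure.real]

lemma continuous_sum_comp_sub {f : EuclideanSpace ℝ (Fin d) → ℂ} (hf : Continuous f)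
    (S : Finset (EuclideanSpace ℝ (Fin d))) :
    Continuous fun t => ∑ x ∈ S, f (x - t) := by fun_prop

lemma hasCompactSupport_sum_comp_sub {f : EuclideanSpace ℝ (Fin d) → ℂ} (hc : HasCompactSupport f)
    (S : Finset (EuclideanSpace ℝ (Fin d))) :
    HasCompactSupport fun t => ∑ x ∈ S, f (x - t) := by
  classical
  induction S using Finset.induction_on with
  | empty => simpa using! HasCompactSupport.zero
  | insert a s ha ih =>
    simp_rw [Finset.sum_insert ha]
    exact (hc.comp_homeomorph (Homeomorph.subLeft a)).add ih

/-- Positive definiteness of `f * f~` in explicit form: after `t ↦ x - t` each term is a product of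
a function of `x` and the conjugate of the same function of `y`, so the double sum factors under the
integral. -/
lemma sum_selfCorr_sub {f : EuclideanSpace ℝ (Fin d) → ℂ} (hf : Continuous f)
    (hc : HasCompactSupport f) (S : Finset (EuclideanSpace ℝ (Fin d))) :
    ∑ x ∈ S, ∑ y ∈ S, selfCorr f (x - y) = ((∫ t, ‖∑ x ∈ S, f (x - t)‖ ^ 2 : ℝ) : ℂ) := by
  have h1 : ∀ x y : EuclideanSpace ℝ (Fin d), selfCorr f (x - y) = ∫ t,
      f (x - t) * conj (f (y - t)) := by
    intro x y
    rw [selfCorr_apply, ← integral_sub_left_eq_self _ volume x]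
    congr 1
    ext t
    congr 3
    abel
  have hi : ∀ x y : EuclideanSpace ℝ (Fin d), Integrable fun t => f (x - t) * conj (f (y - t)) := by
    intro x y
    refine Continuous.integrable_of_hasCompactSupport (by fun_prop) ?_
    exact (hc.comp_homeomorph (Homeomorph.subLeft x)).mul_right
  simp_rw [h1]
  rw [← integral_complex_ofReal]
  simp_rw [← integral_finsetSum S fun y _ => hi _ y]
  rw [← integral_finsetSum S fun x _ => integrable_finsetSum S fun y _ => hi x y]
  congr 1
  ext t
  rw [← Complex.normSq_eq_norm_sq, ← Complex.mul_conj, map_sum, Finset.sum_mul_sum]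

lemma fourier_sum_comp_sub {f : EuclideanSpace ℝ (Fin d) → ℂ} (hf : Integrable f)
    (S : Finset (EuclideanSpace ℝ (Fin d))) (ξ : EuclideanSpace ℝ (Fin d)) :
    𝓕 (fun t => ∑ x ∈ S, f (x - t)) ξ =
      (∑ x ∈ S, Complex.exp (↑(-2 * Real.pi * inner ℝ x ξ) * Complex.I)) * 𝓕⁻ f ξ := by
  have hi : ∀ x : EuclideanSpace ℝ (Fin d), Integrable fun t =>
      Complex.exp (↑(-2 * Real.pi * inner ℝ t ξ) * Complex.I) * f (x - t) := by
    intro x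
    refine (hf.comp_sub_left x).bdd_mul (c := 1) (by fun_prop) (Eventually.of_forall fun t => ?_)
    rw [Complex.norm_exp_ofReal_mul_I]
  simp only [Real.fourier_eq', Real.fourierInv_eq', smul_eq_mul, Finset.mul_sum]
  rw [integral_finsetSum S fun x _ => hi x, Finset.sum_mul]
  refine Finset.sum_congr rfl fun x _ => ?_
  rw [← integral_const_mul, ← integral_sub_left_eq_self _ volume x]
  congr 1
  ext t
  rw [← mul_assoc, ← Complex.exp_add, sub_sub_cancel]
  congr 2
  rw [inner_sub_left]
  push_cast
  ring

lemma isFourierTransform_autocorrApprox {Γ A : Set (EuclideanSpace ℝ (Fin d))}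
    (hA : MeasurableSet A) (hfin : (Γ ∩ A).Finite) :
    ∃ μ : Measure (EuclideanSpace ℝ (Fin d)),
        IsFourierTransform (autocorrApprox (diracComb Γ) A) μ := by
  set S := hfin.toFinset with hSdef
  have hS : ∀ x, x ∈ S ↔ x ∈ Γ ∩ A := fun x => hfin.mem_toFinset
  -- The density is the normalized squared modulus of the exponential sum over `Γ ∩ A`. It is also
  -- the factor relating `|f^∨|²` to the squared Fourier transform of `t ↦ ∑ f(x - t)`, so
  -- Plancherel applies to the latter.
  let p : EuclideanSpace ℝ (Fin d) → ℝ := fun ξ => (volume.real A)⁻¹ *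
    ‖∑ x ∈ S, Complex.exp (↑(-2 * Real.pi * inner ℝ x ξ) * Complex.I)‖ ^ 2
  have hp : Continuous p := by fun_prop
  have hp0 : ∀ ξ, 0 ≤ p ξ := fun ξ => by positivity
  have hpm : Measurable fun ξ => ENNReal.ofReal (p ξ) := by fun_prop
  have key : ∀ f : EuclideanSpace ℝ (Fin d) → ℂ, Integrable f →
      (fun ξ => (ENNReal.ofReal (p ξ)).toReal • ‖𝓕⁻ f ξ‖ ^ 2) =
      fun ξ => (volume.real A)⁻¹ * ‖𝓕 (fun t => ∑ x ∈ S, f (x - t)) ξ‖ ^ 2 := by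
    intro f hf
    ext ξ
    rw [fourier_sum_comp_sub hf, ENNReal.toReal_ofReal (hp0 ξ), norm_mul, smul_eq_mul]
    ring
  refine ⟨volume.withDensity fun ξ => ENNReal.ofReal (p ξ),
    IsLocallyFiniteMeasure.withDensity_ofReal hp, fun f hf hc => ?_, fun f hf hc => ?_⟩
  · have hfi : Integrable f := hf.integrable_of_hasCompactSupport hc
    rw [integrable_withDensity_iff_integrable_smul' hpm (by simp), key f hfi]
    exact (plancherel_of_hasCompactSupport (continuous_sum_comp_sub hf S)
      (hasCompactSupport_sum_comp_sub hc S)).1.const_mul _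
  · have hfi : Integrable f := hf.integrable_of_hasCompactSupport hc
    change ∫ x, selfCorr f x ∂_ = _
    rw [integral_withDensity_eq_integral_toReal_smul hpm (by simp), key f hfi, integral_const_mul,
      (plancherel_of_hasCompactSupport (continuous_sum_comp_sub hf S)
      (hasCompactSupport_sum_comp_sub hc S)).2, integral_autocorrApprox_diracComb hA hS,
      sum_selfCorr_sub hf hc]
    push_cast
    rfl

lemma isFiniteMeasure_autocorrApprox {Γ A : Set (EuclideanSpace ℝ (Fin d))} (hA : MeasurableSet A)
    (hA0 : 0 < volume A)
    (hfin : (Γ ∩ A).Finite) : IsFiniteMeasure (autocorrApprox (diracComb Γ) A) := by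
  rw [autocorrApprox_diracComb hA (S := hfin.toFinset) fun x => hfin.mem_toFinset]
  exact Measure.smul_finite _ (ENNReal.inv_ne_top.2 hA0.ne')

end FiniteAutocorrelation

/-! ### Mollifiers, cutoffs and compactness of measures -/

section Existence

set_option linter.unusedSectionVars false

section Bump

variable {V : Type*} [NormedAddCommGroup V] [InnerProductSpace ℝ V] [FiniteDimensional ℝ V]
  [MeasurableSpace V] [BorelSpace V]

/-- A continuous probability density supported in the ball of radius `r`. -/
structure IsMollifier (u : V → ℝ) (r : ℝ) : Prop where
  continuous : Continuous u
  hasCompactSupport : HasCompactSupport u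
  nonneg : ∀ x, 0 ≤ u x
  integral_eq_one : ∫ x, u x = 1
  eq_zero : ∀ x, r ≤ ‖x‖ → u x = 0

variable (V) in
lemma exists_isMollifier {r : ℝ} (hr : 0 < r) : ∃ u : V → ℝ, IsMollifier u r := by
  let φ : ContDiffBump (0 : V) := ⟨r / 2, r, by positivity, by linarith⟩
  refine ⟨φ.normed volume, φ.continuous_normed, φ.hasCompactSupport_normed,
    fun x => φ.nonneg_normed x, φ.integral_normed, fun x hx => ?_⟩
  rw [← Function.notMem_support, φ.support_normed_eq]
  simpa [φ] using hx

namespace IsMollifier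

variable {u : V → ℝ} {r : ℝ}

lemma integrable (hu : IsMollifier u r) : Integrable u :=
  hu.continuous.integrable_of_hasCompactSupport hu.hasCompactSupport

lemma continuous_ofReal (hu : IsMollifier u r) : Continuous fun x => (u x : ℂ) :=
  Complex.continuous_ofReal.comp hu.continuous

lemma hasCompactSupport_ofReal (hu : IsMollifier u r) : HasCompactSupport fun x => (u x : ℂ) :=
  hu.hasCompactSupport.comp_left (g := Complex.ofReal) rfl

lemma integrable_ofReal (hu : IsMollifier u r) : Integrable fun x => (u x : ℂ) :=
  hu.continuous_ofReal.integrable_of_hasCompactSupport hu.hasCompactSupport_ofReal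

/-- A bound for averages against a mollifier. -/
lemma norm_integral_mul_sub_le (hu : IsMollifier u r) {g : V → ℂ} {c : ℂ} {ε : ℝ}
    (hg : Continuous g) (h : ∀ x, ‖x‖ < r → ‖g x - c‖ ≤ ε) :
    ‖(∫ x, (u x : ℂ) * g x) - c‖ ≤ ε := by
  have h1 : ∫ x, (u x : ℂ) * c = c := by
    rw [integral_mul_const, integral_complex_ofReal, hu.integral_eq_one]; simp
  have hi : ∀ g : V → ℂ, Continuous g → Integrable fun x => (u x : ℂ) * g x := fun g hg =>
    (hu.continuous_ofReal.mul hg).integrable_of_hasCompactSupport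
      hu.hasCompactSupport_ofReal.mul_right
  have h2 : (∫ x, (u x : ℂ) * g x) - c = ∫ x, (u x : ℂ) * (g x - c) := by
    conv_lhs => rw [← h1]
    rw [← integral_sub (hi g hg) (hi _ continuous_const)]
    simp_rw [mul_sub]
  rw [h2]
  calc ‖∫ x, (u x : ℂ) * (g x - c)‖ ≤ ∫ x, u x * ε := by
        refine norm_integral_le_of_norm_le (hu.integrable.mul_const _)
          (Eventually.of_forall fun x => ?_)
        rw [norm_mul, Complex.norm_real, Real.norm_of_nonneg (hu.nonneg x)]
        by_cases hx : ‖x‖ < r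
        · exact mul_le_mul_of_nonneg_left (h x hx) (hu.nonneg x)
        · simp [hu.eq_zero x (not_lt.1 hx)]
    _ = ε := by rw [integral_mul_const, hu.integral_eq_one, one_mul]

lemma norm_convolution_sub_le (hu : IsMollifier u r) {f : V → ℂ} {ε : ℝ}
    (hf : Continuous f) {x : V} (h : ∀ t, ‖t‖ < r → ‖f (x - t) - f x‖ ≤ ε) :
    ‖((fun x => (u x : ℂ)) ⋆[ContinuousLinearMap.mul ℂ ℂ] f) x - f x‖ ≤ ε := by
  simp only [convolution_def, ContinuousLinearMap.mul_apply']
  exact hu.norm_integral_mul_sub_le (by fun_prop) h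

/-- On the support of `u` the character of `ξ` differs from `1` by at most `2πr‖ξ‖`, and `u` has
mass one. -/
lemma norm_fourierInv_sub_one_le (hu : IsMollifier u r) (ξ : V) :
    ‖𝓕⁻ (fun x => (u x : ℂ)) ξ - 1‖ ≤ 2 * Real.pi * r * ‖ξ‖ := by
  rw [Real.fourierInv_eq']
  simp_rw [smul_eq_mul, mul_comm _ (u _ : ℂ)]
  refine hu.norm_integral_mul_sub_le (by fun_prop) fun x hx => ?_
  rw [mul_comm]
  refine (Real.norm_exp_I_mul_ofReal_sub_one_le).trans ?_
  rw [norm_mul, norm_mul, Real.norm_of_nonneg Real.pi_pos.le, Real.norm_of_nonneg zero_le_two,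
    mul_assoc _ r]
  have := (norm_inner_le_norm (𝕜 := ℝ) x ξ).trans (mul_le_mul_of_nonneg_right hx.le (norm_nonneg ξ))
  gcongr

end IsMollifier

lemma exists_one_le_norm_fourierInv (R : ℝ) :
    ∃ f : V → ℂ, Continuous f ∧ HasCompactSupport f ∧ ∀ ξ, ‖ξ‖ ≤ R → 1 ≤ ‖𝓕⁻ f ξ‖ ^ 2 := by
  -- With this radius the transform of `u` is within `1/2` of `1` whenever `‖ξ‖ ≤ |R| + 1`; doubling
  -- `u` brings the modulus up to at least `1`.
  have hr : 0 < (4 * Real.pi * (|R| + 1))⁻¹ := by positivity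
  obtain ⟨u, hu⟩ := exists_isMollifier V hr
  refine ⟨fun x => 2 * (u x : ℂ), continuous_const.mul hu.continuous_ofReal,
    hu.hasCompactSupport_ofReal.mul_left, fun ξ hξ => ?_⟩
  have h1 : 𝓕⁻ (fun x => 2 * (u x : ℂ)) ξ = 2 * 𝓕⁻ (fun x => (u x : ℂ)) ξ := by
    simp only [Real.fourierInv_eq', smul_eq_mul]
    rw [← integral_const_mul]
    congr 1
    ext v
    ring
  have h2 := hu.norm_fourierInv_sub_one_le ξ
  have h3 : 2 * Real.pi * (4 * Real.pi * (|R| + 1))⁻¹ * ‖ξ‖ ≤ 1 / 2 := by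
    have : ‖ξ‖ ≤ |R| + 1 := by linarith [le_abs_self R]
    rw [mul_inv, mul_inv]
    calc 2 * Real.pi * (4⁻¹ * Real.pi⁻¹ * (|R| + 1)⁻¹) * ‖ξ‖
        ≤ 2 * Real.pi * (4⁻¹ * Real.pi⁻¹ * (|R| + 1)⁻¹) * (|R| + 1) := by gcongr
      _ = 1 / 2 := by
        have := Real.pi_ne_zero
        field_simp
        norm_num
  have h4 : 1 ≤ ‖𝓕⁻ (fun x => 2 * (u x : ℂ)) ξ‖ := by
    rw [h1, norm_mul]
    have := norm_sub_norm_le (1 : ℂ) (1 - 𝓕⁻ (fun x => (u x : ℂ)) ξ)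
    rw [norm_sub_rev (1 : ℂ) (𝓕⁻ (fun x => (u x : ℂ)) ξ), sub_sub_cancel] at this
    simp at this ⊢
    linarith
  nlinarith

lemma fourierInv_convolution {f g : V → ℂ} (hf : Integrable f) (hg : Integrable g) (ξ : V) :
    𝓕⁻ (f ⋆[ContinuousLinearMap.mul ℂ ℂ] g) ξ = 𝓕⁻ f ξ * 𝓕⁻ g ξ := by
  simp_rw [Real.fourierInv_eq_fourier_neg]
  exact Real.fourier_mul_convolution_eq hf hg _

lemma tendsto_fourierInv_cocompact (f : V → ℂ) : Tendsto (𝓕⁻ f) (cocompact V) (𝓝 0) := by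
  have h : Tendsto (𝓕 f) (cocompact V) (𝓝 0) := tendsto_integral_exp_inner_smul_cocompact f
  have : 𝓕⁻ f = 𝓕 f ∘ (Homeomorph.neg V) :=
    funext fun ξ => Real.fourierInv_eq_fourier_neg f ξ
  rw [this]
  exact h.comp (Homeomorph.neg V).isClosedEmbedding.tendsto_cocompact

lemma exists_cutoff (R : ℝ) : ∃ χ : V → ℝ, Continuous χ ∧ HasCompactSupport χ ∧
    (∀ x, 0 ≤ χ x) ∧ (∀ x, χ x ≤ 1) ∧ ∀ x, ‖x‖ ≤ R → χ x = 1 := by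
  obtain ⟨χ, h1, -, h2, h3⟩ := exists_continuous_one_zero_of_isCompact
    (isCompact_closedBall (0 : V) R) isClosed_empty (Set.disjoint_empty _)
  exact ⟨χ, χ.continuous, h2, fun x => (h3 x).1, fun x => (h3 x).2,
    fun x hx => h1 (by simpa using hx)⟩

/-- The measure enters only through `∫ χ dγ`, so the estimate is uniform over a family of measures
on which that integral is bounded. -/
lemma norm_integral_selfCorr_le {γ : Measure V} [IsLocallyFiniteMeasure γ] {g : V → ℂ} {r η : ℝ}
    (hη : 0 ≤ η) (hg : ∀ x, r < ‖x‖ → g x = 0)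
    (hb : ∀ x, ‖g x‖ ≤ η) {χ : V → ℝ} (hχ : Continuous χ) (hχc : HasCompactSupport χ)
    (hχ0 : ∀ x, 0 ≤ χ x) (hχ1 : ∀ x, ‖x‖ ≤ 2 * r → χ x = 1) :
    ‖∫ x, selfCorr g x ∂γ‖ ≤ η ^ 2 * volume.real (Metric.closedBall (0 : V) r) * ∫ x, χ x ∂γ := by
  rw [← integral_const_mul]
  refine norm_integral_le_of_norm_le ((hχ.integrable_of_hasCompactSupport hχc).const_mul _)
    (Eventually.of_forall fun x => ?_)
  by_cases hx : ‖x‖ ≤ 2 * r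
  · rw [hχ1 x hx, mul_one]
    exact norm_selfCorr_le hη hg hb x
  · rw [selfCorr_eq_zero hg (not_le.1 hx), norm_zero]
    exact mul_nonneg (by positivity) (hχ0 x)

end Bump

/-- Along an ultrafilter every bounded sequence of integrals converges, for all test functions at
once and without choosing subsequences. The limits form a positive linear functional, which
Riesz–Markov–Kakutani represents by a measure. -/
lemma exists_ultrafilter_limit {X : Type*} [TopologicalSpace X] [T2Space X]
    [LocallyCompactSpace X] [MeasurableSpace X] [BorelSpace X] (μ : ℕ → Measure X)
    [∀ n, IsFiniteMeasureOnCompacts (μ n)] (U : Ultrafilter ℕ)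
    (hμ : ∀ φ : X → ℝ, Continuous φ → HasCompactSupport φ → ∃ M, ∀ n, |∫ x, φ x ∂(μ n)| ≤ M) :
    ∃ ν : Measure X, IsFiniteMeasureOnCompacts ν ∧ ∀ φ : X → ℝ, Continuous φ →
      HasCompactSupport φ → Tendsto (fun n => ∫ x, φ x ∂(μ n)) U (𝓝 (∫ x, φ x ∂ν)) := by
  have hlim : ∀ φ : CompactlySupportedContinuousMap X ℝ,
      ∃ l, Tendsto (fun n => ∫ x, φ x ∂(μ n)) U (𝓝 l) := by
    intro φ
    obtain ⟨M, hM⟩ := hμ φ φ.continuous φ.hasCompactSupport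
    obtain ⟨l, -, hl⟩ := (isCompact_Icc (a := -M) (b := M)).ultrafilter_le_nhds
      (U.map fun n => ∫ x, φ x ∂(μ n))
      (le_principal_iff.2 (Ultrafilter.mem_map.2 (Eventually.of_forall fun n => abs_le.1 (hM n))))
    exact ⟨l, hl⟩
  choose Λ hΛ using hlim
  let L : CompactlySupportedContinuousMap X ℝ →ₗ[ℝ] ℝ :=
    { toFun := Λ
      map_add' := fun f g => tendsto_nhds_unique (hΛ (f + g)) <|
        ((hΛ f).add (hΛ g)).congr fun n => (integral_add f.integrable g.integrable).symm
      map_smul' := fun c f => tendsto_nhds_unique (hΛ (c • f)) <|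
        ((hΛ f).const_smul c).congr fun n => (integral_smul c f).symm }
  let P : CompactlySupportedContinuousMap X ℝ →ₚ[ℝ] ℝ := PositiveLinearMap.mk₀ L fun f hf =>
    ge_of_tendsto' (hΛ f) fun n => integral_nonneg hf
  refine ⟨RealRMK.rieszMeasure P, inferInstance, fun φ hφ hc => ?_⟩
  have h1 := hΛ ⟨⟨φ, hφ⟩, hc⟩
  have h2 := RealRMK.integral_rieszMeasure P ⟨⟨φ, hφ⟩, hc⟩
  have h3 : P ⟨⟨φ, hφ⟩, hc⟩ = Λ ⟨⟨φ, hφ⟩, hc⟩ := rfl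
  rw [h3] at h2
  rw [← h2] at h1
  exact h1

end Existence

/-! ### Fourier transforms under vague limits -/

section VagueLimit

variable {d : ℕ}

lemma IsFourierTransform.integral_selfCorr {γ μ : Measure (EuclideanSpace ℝ (Fin d))}
    (h : IsFourierTransform γ μ)
    {f : EuclideanSpace ℝ (Fin d) → ℂ} (hf : Continuous f) (hc : HasCompactSupport f) :
    ∫ x, selfCorr f x ∂γ = ((∫ ξ, ‖𝓕⁻ f ξ‖ ^ 2 ∂μ : ℝ) : ℂ) :=
  h.integral_eq f hf hc

lemma exists_bound_of_tendsto_integral {γn : ℕ → Measure (EuclideanSpace ℝ (Fin d))}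
    {l : ℂ} {f : EuclideanSpace ℝ (Fin d) → ℂ}
    (h : Tendsto (fun n => ∫ x, f x ∂(γn n)) atTop (𝓝 l)) :
    ∃ M, ∀ n, ‖∫ x, f x ∂(γn n)‖ ≤ M := by
  obtain ⟨M, hM⟩ := h.norm.bddAbove_range
  exact ⟨M, fun n => hM ⟨n, rfl⟩⟩

variable {γn μn : ℕ → Measure (EuclideanSpace ℝ (Fin d))} {γ : Measure (EuclideanSpace ℝ (Fin d))}

/-- Uniform integrability at infinity of `|f^∨|²` along the Fourier transforms of a vaguely
convergent sequence of measures. -/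
lemma exists_integral_le_integral_cutoff_add [∀ n, IsLocallyFiniteMeasure (γn n)]
    (hμ : ∀ n, IsFourierTransform (γn n) (μn n))
    (hlim : ∀ f : EuclideanSpace ℝ (Fin d) → ℂ, Continuous f → HasCompactSupport f →
      Tendsto (fun n => ∫ x, f x ∂(γn n)) atTop (𝓝 (∫ x, f x ∂γ)))
    {f : EuclideanSpace ℝ (Fin d) → ℂ} (hf : Continuous f) (hc : HasCompactSupport f) {ε : ℝ} (hε : 0 < ε) :
    ∃ R : ℝ, ∀ χ : EuclideanSpace ℝ (Fin d) → ℝ, Continuous χ → HasCompactSupport χ →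
        (∀ x, 0 ≤ χ x) →
      (∀ x, ‖x‖ ≤ R → χ x = 1) → ∀ n,
      ∫ ξ, ‖𝓕⁻ f ξ‖ ^ 2 ∂(μn n) ≤ ∫ ξ, χ ξ * ‖𝓕⁻ f ξ‖ ^ 2 ∂(μn n) + ε := by
  obtain ⟨ρ, hρ⟩ := hc.isCompact.isBounded.subset_closedBall (0 : EuclideanSpace ℝ (Fin d))
  have hfρ : ∀ x, ρ < ‖x‖ → f x = 0 := fun x hx => by
    by_contra h
    have := hρ (subset_tsupport f h)
    rw [mem_closedBall_zero_iff] at this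
    linarith
  obtain ⟨ψ, hψ, hψc, hψ0, -, hψ1⟩ := exists_cutoff (V := EuclideanSpace ℝ (Fin d)) (2 * (ρ + 1))
  obtain ⟨M, hM⟩ := exists_bound_of_tendsto_integral
    (hlim (fun x => (ψ x : ℂ)) (Complex.continuous_ofReal.comp hψ)
      (hψc.comp_left (g := Complex.ofReal) rfl))
  set W := volume.real (Metric.closedBall (0 : EuclideanSpace ℝ (Fin d)) (ρ + 1)) with hW
  have hM0 : 0 ≤ M := (norm_nonneg _).trans (hM 0)
  -- `η² W M` will bound `∫ |g^∨|² dμ_n` for every `n`. The factor `4` comes from `|f^∨|² ≤ 4|g^∨|²`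
  -- outside a large ball.
  obtain ⟨η, hη, hηε⟩ : ∃ η : ℝ, 0 < η ∧ 4 * (η ^ 2 * W * M) ≤ ε := by
    refine ⟨√(ε / (4 * (W * M + 1))), by positivity, ?_⟩
    have : 0 ≤ W * M := by positivity
    rw [Real.sq_sqrt (by positivity), ← sub_nonneg]
    have : ε - 4 * (ε / (4 * (W * M + 1)) * W * M) = ε / (W * M + 1) := by
      field_simp
      ring
    rw [this]
    positivity
  obtain ⟨δ, hδ, hδf⟩ :=
    Metric.uniformContinuous_iff.1 (hc.uniformContinuous_of_continuous hf) η hη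
  -- Radius at most `δ` makes `u * f` uniformly `η`-close to `f`; radius at most `1` keeps the
  -- support of `u * f - f` in the ball of radius `ρ + 1`, independently of `η`.
  obtain ⟨u, hu⟩ := exists_isMollifier (EuclideanSpace ℝ (Fin d)) (r := min δ 1) (by positivity)
  have hfi : Integrable f := hf.integrable_of_hasCompactSupport hc
  set c : EuclideanSpace ℝ (Fin d) → ℂ :=
      (fun x => (u x : ℂ)) ⋆[ContinuousLinearMap.mul ℂ ℂ] f with hcdef
  have hcc : Continuous c := HasCompactSupport.continuous_convolution_left _
    hu.hasCompactSupport_ofReal hu.continuous_ofReal hfi.locallyIntegrable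
  have hcs : HasCompactSupport c := HasCompactSupport.convolution _ hu.hasCompactSupport_ofReal hc
  set g : EuclideanSpace ℝ (Fin d) → ℂ := c - f with hg
  have hgc : Continuous g := hcc.sub hf
  have hgs : HasCompactSupport g := hcs.sub hc
  have hgη : ∀ x, ‖g x‖ ≤ η := fun x => by
    refine hu.norm_convolution_sub_le hf fun t ht => ?_
    rw [← dist_eq_norm]
    refine (hδf ?_).le
    rw [dist_eq_norm, sub_sub_cancel_left, norm_neg]
    exact ht.trans_le (min_le_left _ _)
  have hg0 : ∀ x, ρ + 1 < ‖x‖ → g x = 0 := fun x hx => by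
    have h1 : f x = 0 := hfρ x (by linarith)
    have h2 : c x = 0 := by
      rw [hcdef, convolution_def]
      refine integral_eq_zero_of_ae (Eventually.of_forall fun t => ?_)
      by_cases ht : min δ 1 ≤ ‖t‖
      · simp [hu.eq_zero t ht]
      · have h3 : ‖t‖ < 1 := (not_le.1 ht).trans_le (min_le_right _ _)
        have := norm_sub_norm_le x t
        simp [hfρ (x - t) (by linarith)]
    simp [hg, h1, h2]
  -- Riemann–Lebesgue: beyond `R` the factor `u^∨ - 1` has modulus at least `1/2`.
  obtain ⟨R, hR⟩ : ∃ R : ℝ, ∀ ξ : EuclideanSpace ℝ (Fin d), R < ‖ξ‖ → ‖𝓕⁻ (fun x => (u x : ℂ)) ξ‖ ≤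
      1 / 2 := by
    have h1 := (tendsto_fourierInv_cocompact (fun x : EuclideanSpace ℝ (Fin d) => (u x : ℂ))).norm
    rw [norm_zero] at h1
    have h2 := h1.eventually (eventually_le_nhds (show (0 : ℝ) < 1 / 2 by norm_num))
    obtain ⟨R, hR⟩ := Metric.closedBall_compl_subset_of_mem_cocompact h2 0
    exact ⟨R, fun ξ hξ => hR (by simpa using hξ)⟩
  have hFg : ∀ ξ, 𝓕⁻ g ξ = (𝓕⁻ (fun x => (u x : ℂ)) ξ - 1) * 𝓕⁻ f ξ := fun ξ => by
    have h1 : 𝓕⁻ g ξ = 𝓕⁻ c ξ - 𝓕⁻ f ξ := by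
      simp only [Real.fourierInv_eq]
      rw [← integral_sub]
      · simp [hg, smul_sub]
      · simpa using (Real.fourierIntegral_convergent_iff (-ξ)).2
          (hcc.integrable_of_hasCompactSupport hcs : Integrable c)
      · simpa using (Real.fourierIntegral_convergent_iff (-ξ)).2 hfi
    rw [h1, hcdef, fourierInv_convolution hu.integrable_ofReal hfi]
    ring
  refine ⟨R, fun χ hχ hχc hχ0 hχ1 n => ?_⟩
  have hIf := (hμ n).integrable f hf hc
  have hIg := (hμ n).integrable g hgc hgs
  have := (hμ n).isLocallyFinite
  have hχf : Integrable (fun ξ => χ ξ * ‖𝓕⁻ f ξ‖ ^ 2) (μn n) :=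
    (hχ.mul ((continuous_fourierInv hfi).norm.pow 2)).integrable_of_hasCompactSupport
      hχc.mul_right
  have hpt : ∀ ξ, ‖𝓕⁻ f ξ‖ ^ 2 ≤ χ ξ * ‖𝓕⁻ f ξ‖ ^ 2 + 4 * ‖𝓕⁻ g ξ‖ ^ 2 := fun ξ => by
    by_cases hξ : ‖ξ‖ ≤ R
    · rw [hχ1 ξ hξ]
      nlinarith [sq_nonneg ‖𝓕⁻ g ξ‖]
    · have h1 := hR ξ (not_le.1 hξ)
      have h2 : 1 / 2 ≤ ‖𝓕⁻ (fun x => (u x : ℂ)) ξ - 1‖ := by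
        have := norm_sub_norm_le (1 : ℂ) (𝓕⁻ (fun x => (u x : ℂ)) ξ)
        rw [norm_sub_rev, norm_one] at this
        linarith
      have h3 : (1 / 2) ^ 2 * ‖𝓕⁻ f ξ‖ ^ 2 ≤ ‖𝓕⁻ g ξ‖ ^ 2 := by
        rw [hFg, norm_mul, mul_pow]
        gcongr
      have h4 : 0 ≤ χ ξ * ‖𝓕⁻ f ξ‖ ^ 2 := mul_nonneg (hχ0 ξ) (by positivity)
      linarith
  calc ∫ ξ, ‖𝓕⁻ f ξ‖ ^ 2 ∂(μn n)
      ≤ ∫ ξ, (χ ξ * ‖𝓕⁻ f ξ‖ ^ 2 + 4 * ‖𝓕⁻ g ξ‖ ^ 2) ∂(μn n) :=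
        integral_mono hIf (hχf.add (hIg.const_mul 4)) hpt
    _ = ∫ ξ, χ ξ * ‖𝓕⁻ f ξ‖ ^ 2 ∂(μn n) + 4 * ∫ ξ, ‖𝓕⁻ g ξ‖ ^ 2 ∂(μn n) := by
        rw [integral_add hχf (hIg.const_mul 4), integral_const_mul]
    _ ≤ _ := by
        gcongr
        have h1 : ∫ ξ, ‖𝓕⁻ g ξ‖ ^ 2 ∂(μn n) = ‖∫ x, selfCorr g x ∂(γn n)‖ := by
          rw [(hμ n).integral_selfCorr hgc hgs, Complex.norm_real, Real.norm_of_nonneg]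
          exact integral_nonneg fun _ => by positivity
        have h2 := norm_integral_selfCorr_le (γ := γn n) hη.le hg0 hgη hψ hψc hψ0 hψ1
        have h3 : ∫ x, ψ x ∂(γn n) ≤ M := by
          have := hM n
          rw [integral_complex_ofReal, Complex.norm_real] at this
          exact (le_abs_self _).trans this
        rw [h1]
        refine le_trans ?_ hηε
        gcongr
        exact h2.trans (by gcongr)

/-- Fourier transformability with positive Fourier transform passes to vague limits. -/
theorem exists_isFourierTransform_of_tendsto [∀ n, IsLocallyFiniteMeasure (γn n)]
    (hμ : ∀ n, IsFourierTransform (γn n) (μn n))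
    (hlim : ∀ f : EuclideanSpace ℝ (Fin d) → ℂ, Continuous f → HasCompactSupport f →
      Tendsto (fun n => ∫ x, f x ∂(γn n)) atTop (𝓝 (∫ x, f x ∂γ))) :
    ∃ μ : Measure (EuclideanSpace ℝ (Fin d)), IsFourierTransform γ μ := by
  have := fun n => (hμ n).isLocallyFinite
  have hlim' : ∀ f : EuclideanSpace ℝ (Fin d) → ℂ, Continuous f → HasCompactSupport f →
      Tendsto (fun n => ((∫ ξ, ‖𝓕⁻ f ξ‖ ^ 2 ∂(μn n) : ℝ) : ℂ)) atTop
        (𝓝 (∫ x, selfCorr f x ∂γ)) := fun f hf hc =>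
    (hlim _ (continuous_selfCorr hf hc) (hasCompactSupport_selfCorr hc)).congr fun n =>
      (hμ n).integral_selfCorr hf hc
  -- The test function `φ` is dominated by `C |f^∨|²`, with `f` chosen so that `|f^∨|² ≥ 1` on a
  -- ball containing the support of `φ`. The integrals of `|f^∨|²` converge, hence are bounded.
  obtain ⟨ν, hν, hνlim⟩ := exists_ultrafilter_limit μn (hyperfilter ℕ) (by
    intro φ hφ hφc
    obtain ⟨R, hR⟩ := hφc.isCompact.isBounded.subset_closedBall (0 : EuclideanSpace ℝ (Fin d))
    obtain ⟨C, hC⟩ := hφ.bounded_above_of_compact_support hφc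
    obtain ⟨f, hf, hfc, hfR⟩ := exists_one_le_norm_fourierInv (V := EuclideanSpace ℝ (Fin d)) R
    obtain ⟨M, hM⟩ := (hlim' f hf hfc).norm.bddAbove_range
    have hC0 : 0 ≤ C := (norm_nonneg _).trans (hC 0)
    refine ⟨C * M, fun n => ?_⟩
    have h1 : ∫ ξ, ‖𝓕⁻ f ξ‖ ^ 2 ∂(μn n) ≤ M := by
      refine le_trans ?_ (hM ⟨n, rfl⟩)
      simp only [Complex.norm_real]
      exact le_abs_self _
    refine le_trans ?_ (mul_le_mul_of_nonneg_left h1 hC0)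
    rw [← integral_const_mul, ← Real.norm_eq_abs]
    refine norm_integral_le_of_norm_le (((hμ n).integrable f hf hfc).const_mul _)
      (Eventually.of_forall fun ξ => ?_)
    by_cases hξ : ‖ξ‖ ≤ R
    · exact (hC ξ).trans (le_mul_of_one_le_right hC0 (hfR ξ hξ))
    · have : φ ξ = 0 := by
        by_contra h
        exact hξ (by simpa using hR (subset_tsupport φ h))
      rw [this, norm_zero]
      positivity)
  refine ⟨ν, ?_⟩
  have hle : (hyperfilter ℕ : Filter ℕ) ≤ atTop := Nat.hyperfilter_le_atTop
  have key : ∀ f : EuclideanSpace ℝ (Fin d) → ℂ, Continuous f → HasCompactSupport f →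
      Integrable (fun ξ => ‖𝓕⁻ f ξ‖ ^ 2) ν ∧
      ∫ x, selfCorr f x ∂γ = ((∫ ξ, ‖𝓕⁻ f ξ‖ ^ 2 ∂ν : ℝ) : ℂ) := by
    intro f hf hc
    have hfi : Integrable f := hf.integrable_of_hasCompactSupport hc
    have hwc : Continuous fun ξ => ‖𝓕⁻ f ξ‖ ^ 2 := (continuous_fourierInv hfi).norm.pow 2
    -- The limit is real because it is a limit of real numbers.
    obtain ⟨I, hI, hIlim⟩ : ∃ I : ℝ, ∫ x, selfCorr f x ∂γ = (I : ℂ) ∧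
        Tendsto (fun n => ∫ ξ, ‖𝓕⁻ f ξ‖ ^ 2 ∂(μn n)) atTop (𝓝 I) := by
      have h1 := (Complex.continuous_re.tendsto _).comp (hlim' f hf hc)
      have h2 := (Complex.continuous_im.tendsto _).comp (hlim' f hf hc)
      simp only [Function.comp_def, Complex.ofReal_re, Complex.ofReal_im] at h1 h2
      refine ⟨_, ?_, h1⟩
      apply Complex.ext
      · simp
      · simpa using (tendsto_nhds_unique h2 tendsto_const_nhds)
    have hcut : ∀ χ : EuclideanSpace ℝ (Fin d) → ℝ, Continuous χ → HasCompactSupport χ →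
        (∀ x, 0 ≤ χ x) →
        (∀ x, χ x ≤ 1) → ∫ ξ, χ ξ * ‖𝓕⁻ f ξ‖ ^ 2 ∂ν ≤ I := by
      intro χ hχ hχc hχ0 hχ1
      refine le_of_tendsto_of_tendsto' (hνlim _ (hχ.mul hwc) hχc.mul_right)
        (hIlim.mono_left hle) fun n => ?_
      refine integral_mono ((hχ.mul hwc).integrable_of_hasCompactSupport hχc.mul_right)
        ((hμ n).integrable f hf hc) fun ξ => ?_
      exact mul_le_of_le_one_left (by positivity) (hχ1 ξ)
    have hball : ∀ n : ℕ, ∫ ξ in Metric.closedBall (0 : EuclideanSpace ℝ (Fin d)) n,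
        ‖𝓕⁻ f ξ‖ ^ 2 ∂ν ≤ I := by
      intro n
      obtain ⟨χ, hχ, hχc, hχ0, hχ1, hχn⟩ := exists_cutoff (V := EuclideanSpace ℝ (Fin d)) n
      refine le_trans ?_ (hcut χ hχ hχc hχ0 hχ1)
      rw [← integral_indicator Metric.isClosed_closedBall.measurableSet]
      refine integral_mono
        ((hwc.continuousOn.integrableOn_compact (isCompact_closedBall _ _)).integrable_indicator
          Metric.isClosed_closedBall.measurableSet)
        ((hχ.mul hwc).integrable_of_hasCompactSupport hχc.mul_right) fun ξ => ?_
      by_cases hξ : ξ ∈ Metric.closedBall (0 : EuclideanSpace ℝ (Fin d)) n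
      · simp only [Set.indicator_of_mem hξ]
        rw [hχn ξ (by simpa using hξ), one_mul]
      · simp only [Set.indicator_of_notMem hξ]
        exact mul_nonneg (hχ0 ξ) (by positivity)
    have hcov : AECover ν atTop fun n : ℕ => Metric.closedBall (0 : EuclideanSpace ℝ (Fin d)) n :=
      aecover_closedBall tendsto_natCast_atTop_atTop
    have hint : Integrable (fun ξ => ‖𝓕⁻ f ξ‖ ^ 2) ν :=
      hcov.integrable_of_integral_bounded_of_nonneg_ae I
        (fun n => hwc.continuousOn.integrableOn_compact (isCompact_closedBall _ _))
        (Eventually.of_forall fun ξ => by positivity) (Eventually.of_forall hball)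
    refine ⟨hint, ?_⟩
    rw [hI]
    congr 1
    refine le_antisymm ?_ (le_of_tendsto' (hcov.integral_tendsto_of_countably_generated hint) hball)
    -- The cutoff bounds only give `∫ |f^∨|² dν ≤ I`. Equality needs the uniform tail estimate: up
    -- to `ε`, all of `I` is already seen by one compactly supported cutoff.
    refine le_of_forall_pos_le_add fun ε hε => ?_
    obtain ⟨R, hR⟩ := exists_integral_le_integral_cutoff_add hμ hlim hf hc hε
    obtain ⟨χ, hχ, hχc, hχ0, hχ1, hχR⟩ := exists_cutoff (V := EuclideanSpace ℝ (Fin d)) R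
    have hwχ : HasCompactSupport fun ξ => χ ξ * ‖𝓕⁻ f ξ‖ ^ 2 := hχc.mul_right
    refine (le_of_tendsto_of_tendsto' (hIlim.mono_left hle)
      ((hνlim _ (hχ.mul hwc) hwχ).add_const ε) (hR χ hχ hχc hχ0 hχR)).trans
      (add_le_add ?_ le_rfl)
    refine integral_mono ((hχ.mul hwc).integrable_of_hasCompactSupport hwχ) hint fun ξ => ?_
    exact mul_le_of_le_one_left (by positivity) (hχ1 ξ)
  exact ⟨inferInstance, fun f hf hc => (key f hf hc).1, fun f hf hc => (key f hf hc).2⟩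

end VagueLimit

/-! ### Smoothed indicators and the atom at the origin -/

section Density

variable {d : ℕ}

/-- The indicator function of `A`, normalized to have integral one. -/
noncomputable def normalizedIndicator (A : Set (EuclideanSpace ℝ (Fin d))) :
    EuclideanSpace ℝ (Fin d) → ℂ :=
  A.indicator fun _ => (((volume.real A)⁻¹ : ℝ) : ℂ)

variable {A : Set (EuclideanSpace ℝ (Fin d))}

lemma integrable_normalizedIndicator (hA : MeasurableSet A) (hb : Bornology.IsBounded A) :
    Integrable (normalizedIndicator A) :=
  (integrable_indicator_iff hA).2 (integrableOn_const hb.measure_lt_top.ne)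

lemma volume_real_pos (hb : Bornology.IsBounded A) (h0 : 0 < volume A) : 0 < volume.real A :=
  ENNReal.toReal_pos h0.ne' hb.measure_lt_top.ne

lemma enorm_normalizedIndicator (hb : Bornology.IsBounded A) (h0 : 0 < volume A)
    (x : EuclideanSpace ℝ (Fin d)) :
    ‖normalizedIndicator A x‖ₑ = A.indicator (fun _ => (volume A)⁻¹) x := by
  have h := volume_real_pos hb h0
  have hc : ‖(((volume.real A)⁻¹ : ℝ) : ℂ)‖ₑ = (volume A)⁻¹ := by
    rw [← ofReal_norm, Complex.norm_real, Real.norm_of_nonneg (by positivity),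
      ENNReal.ofReal_inv_of_pos h, Measure.real, ENNReal.ofReal_toReal hb.measure_lt_top.ne]
  by_cases hx : x ∈ A
  · simp only [normalizedIndicator, Set.indicator_of_mem hx, hc]
  · simp only [normalizedIndicator, Set.indicator_of_notMem hx, enorm_zero]

lemma lintegral_enorm_normalizedIndicator (hA : MeasurableSet A) (hb : Bornology.IsBounded A)
    (h0 : 0 < volume A) : ∫⁻ x, ‖normalizedIndicator A x‖ₑ = 1 := by
  simp_rw [enorm_normalizedIndicator hb h0]
  rw [lintegral_indicator_const hA, ENNReal.inv_mul_cancel h0.ne' hb.measure_lt_top.ne]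

lemma enorm_fourierInv_normalizedIndicator_le_one (hA : MeasurableSet A)
    (hb : Bornology.IsBounded A) (h0 : 0 < volume A) (ξ : EuclideanSpace ℝ (Fin d)) :
    ‖𝓕⁻ (normalizedIndicator A) ξ‖ₑ ≤ 1 := by
  rw [Real.fourierInv_eq, ← lintegral_enorm_normalizedIndicator hA hb h0]
  refine (enorm_integral_le_lintegral_enorm _).trans_eq ?_
  congr 1
  ext v
  rw [← ofReal_norm, Circle.norm_smul, ofReal_norm]

lemma fourierInv_normalizedIndicator_zero (hA : MeasurableSet A)
    (hb : Bornology.IsBounded A) (h0 : 0 < volume A) :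
    𝓕⁻ (normalizedIndicator A) 0 = 1 := by
  rw [Real.fourierInv_eq]
  simp only [inner_zero_right, AddChar.map_zero_eq_one, one_smul]
  rw [normalizedIndicator, integral_indicator_const _ hA, Complex.real_smul,
    ← Complex.ofReal_mul, mul_inv_cancel₀ (volume_real_pos hb h0).ne', Complex.ofReal_one]

/-- Both signs of `a` are needed: a point entering the translate lies in `A + K` through `a`, while
a point leaving it lies in `closure Aᶜ - K` through `-a`. -/
lemma enorm_normalizedIndicator_sub_le (hb : Bornology.IsBounded A) (h0 : 0 < volume A)
    (a v : EuclideanSpace ℝ (Fin d)) :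
    ‖normalizedIndicator A v - normalizedIndicator A (v - a)‖ₑ ≤
      (vanHoveBoundary {a, -a} A).indicator (fun _ => (volume A)⁻¹) v := by
  by_cases h1 : v ∈ A <;> by_cases h2 : v - a ∈ A
  · simp [normalizedIndicator, h1, h2]
  · have hv : v ∈ vanHoveBoundary {a, -a} A := by
      refine Or.inr ⟨Set.mem_sub.2 ⟨v - a, subset_closure h2, -a, by simp, by abel⟩, h1⟩
    have h3 : normalizedIndicator A (v - a) = 0 := Set.indicator_of_notMem h2 _
    rw [h3, sub_zero, enorm_normalizedIndicator hb h0, Set.indicator_of_mem hv,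
      Set.indicator_of_mem h1]
  · have hv : v ∈ vanHoveBoundary {a, -a} A := by
      refine Or.inl ⟨Set.mem_add.2 ⟨v - a, h2, a, by simp, by abel⟩, fun h => h1 (interior_subset h)⟩
    have h3 : normalizedIndicator A v = 0 := Set.indicator_of_notMem h1 _
    rw [h3, zero_sub, enorm_neg, enorm_normalizedIndicator hb h0, Set.indicator_of_mem hv,
      Set.indicator_of_mem h2]
  · simp [normalizedIndicator, h1, h2]

/-- If the character of `ξ` takes the value `-1` at `a`, then the Fourier transform of the
normalized indicator of `A` at `ξ` is controlled by the boundary of `A`. -/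
lemma enorm_fourierInv_normalizedIndicator_le (hA : MeasurableSet A)
    (hb : Bornology.IsBounded A) (h0 : 0 < volume A) {a ξ : EuclideanSpace ℝ (Fin d)}
    (ha : inner ℝ a ξ = 1 / 2) :
    ‖𝓕⁻ (normalizedIndicator A) ξ‖ₑ ≤ volume (vanHoveBoundary {a, -a} A) / volume A := by
  set h := normalizedIndicator A with hh
  have hi : Integrable h := integrable_normalizedIndicator hA hb
  have hint : ∀ g : EuclideanSpace ℝ (Fin d) → ℂ, Integrable g → Integrable fun v =>
      Complex.exp (↑(2 * Real.pi * inner ℝ v ξ) * Complex.I) * g v := by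
    intro g hg
    refine hg.bdd_mul (c := 1) (by fun_prop) (Eventually.of_forall fun t => ?_)
    rw [Complex.norm_exp_ofReal_mul_I]
  -- Translation by `a` multiplies the transform by `exp(πi) = -1`, so the difference `h - h(· - a)`
  -- has transform `2 h^∨`.
  have hshift : ∫ v, Complex.exp (↑(2 * Real.pi * inner ℝ v ξ) * Complex.I) * h (v - a) =
      -𝓕⁻ h ξ := by
    rw [← integral_add_right_eq_self _ a, Real.fourierInv_eq', ← integral_neg]
    congr 1
    ext v
    have : (↑(2 * Real.pi * inner ℝ (v + a) ξ) * Complex.I : ℂ) =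
        ↑(2 * Real.pi * inner ℝ v ξ) * Complex.I + Real.pi * Complex.I := by
      rw [inner_add_left, ha]
      push_cast
      ring
    rw [this, Complex.exp_add, Complex.exp_pi_mul_I, add_sub_cancel_right, smul_eq_mul]
    ring
  have hdiff : ∫ v, Complex.exp (↑(2 * Real.pi * inner ℝ v ξ) * Complex.I) * (h v - h (v - a)) =
      2 * 𝓕⁻ h ξ := by
    simp_rw [mul_sub]
    rw [integral_sub (hint h hi) (hint _ (hi.comp_sub_right a)), hshift, Real.fourierInv_eq']
    simp_rw [smul_eq_mul]
    ring
  calc ‖𝓕⁻ h ξ‖ₑ ≤ ‖2 * 𝓕⁻ h ξ‖ₑ := by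
        rw [enorm_mul]
        refine le_mul_of_one_le_left' ?_
        rw [← ofReal_norm]
        simp
    _ ≤ ∫⁻ v, ‖h v - h (v - a)‖ₑ := by
        rw [← hdiff]
        refine (enorm_integral_le_lintegral_enorm _).trans_eq ?_
        congr 1
        ext v
        rw [enorm_mul, ← ofReal_norm, Complex.norm_exp_ofReal_mul_I, ENNReal.ofReal_one, one_mul]
    _ ≤ ∫⁻ v, (vanHoveBoundary {a, -a} A).indicator (fun _ => (volume A)⁻¹) v :=
        lintegral_mono fun v => enorm_normalizedIndicator_sub_le hb h0 a v
    _ ≤ (volume A)⁻¹ * volume (vanHoveBoundary {a, -a} A) := lintegral_indicator_const_le _ _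
    _ = _ := by rw [mul_comm, div_eq_mul_inv]

lemma tendsto_enorm_fourierInv_normalizedIndicator
    {B : ℕ → Set (EuclideanSpace ℝ (Fin d))} (hB : IsVanHove B)
    {ξ : EuclideanSpace ℝ (Fin d)} (hξ : ξ ≠ 0) :
    Tendsto (fun n => ‖𝓕⁻ (normalizedIndicator (B n)) ξ‖ₑ) atTop (𝓝 0) := by
  have hξ' : ‖ξ‖ ≠ 0 := norm_ne_zero_iff.2 hξ
  -- The shift `a = ξ / (2‖ξ‖²)` is where the character of `ξ` takes the value `-1`.
  have ha : inner ℝ ((1 / (2 * ‖ξ‖ ^ 2)) • ξ) ξ = 1 / 2 := by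
    rw [real_inner_smul_left, real_inner_self_eq_norm_sq]
    field_simp
  exact tendsto_of_tendsto_of_tendsto_of_le_of_le tendsto_const_nhds
    (hB.tendsto_boundary _ (Set.toFinite _).isCompact) (fun _ => zero_le)
    fun n => enorm_fourierInv_normalizedIndicator_le (hB.measurableSet n) (hB.isBounded n)
      (hB.volume_pos n) ha

/-- The normalized indicator of `A`, smoothed by convolution with `u`. -/
noncomputable def smoothedIndicator (u : EuclideanSpace ℝ (Fin d) → ℝ)
    (A : Set (EuclideanSpace ℝ (Fin d))) :
    EuclideanSpace ℝ (Fin d) → ℂ :=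
  (fun x => (u x : ℂ)) ⋆[ContinuousLinearMap.mul ℂ ℂ] normalizedIndicator A

variable {u : EuclideanSpace ℝ (Fin d) → ℝ}

lemma continuous_smoothedIndicator (hu : IsMollifier u 1) (hA : MeasurableSet A)
    (hb : Bornology.IsBounded A) : Continuous (smoothedIndicator u A) :=
  HasCompactSupport.continuous_convolution_left _ hu.hasCompactSupport_ofReal
    hu.continuous_ofReal (integrable_normalizedIndicator hA hb).locallyIntegrable

lemma hasCompactSupport_smoothedIndicator (hu : IsMollifier u 1)
    (hb : Bornology.IsBounded A) : HasCompactSupport (smoothedIndicator u A) := by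
  refine HasCompactSupport.convolution _ hu.hasCompactSupport_ofReal ?_
  exact HasCompactSupport.intro hb.isCompact_closure fun x hx =>
    Set.indicator_of_notMem (fun h => hx (subset_closure h)) _

lemma enorm_fourierInv_smoothedIndicator (hu : IsMollifier u 1) (hA : MeasurableSet A)
    (hb : Bornology.IsBounded A) (ξ : EuclideanSpace ℝ (Fin d)) :
    ‖𝓕⁻ (smoothedIndicator u A) ξ‖ₑ =
      ‖𝓕⁻ (fun x => (u x : ℂ)) ξ‖ₑ * ‖𝓕⁻ (normalizedIndicator A) ξ‖ₑ := by
  rw [smoothedIndicator, fourierInv_convolution hu.integrable_ofReal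
    (integrable_normalizedIndicator hA hb), enorm_mul]

/-- The smoothing provides more than continuity: its factor `|u^∨|²` is an integrable majorant
independent of `n`, because `u` is itself an admissible test function. -/
lemma tendsto_lintegral_fourierInv_smoothedIndicator {γ μ : Measure (EuclideanSpace ℝ (Fin d))}
    (hμ : IsFourierTransform γ μ) (hu : IsMollifier u 1)
    {B : ℕ → Set (EuclideanSpace ℝ (Fin d))} (hB : IsVanHove B) :
    Tendsto (fun n => ∫⁻ ξ, ‖𝓕⁻ (smoothedIndicator u (B n)) ξ‖ₑ ^ 2 ∂μ) atTop (𝓝 (μ {0})) := by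
  have hu0 : ‖𝓕⁻ (fun x => (u x : ℂ)) 0‖ₑ = 1 := by
    rw [Real.fourierInv_eq]
    simp only [inner_zero_right, AddChar.map_zero_eq_one, one_smul]
    rw [integral_complex_ofReal, hu.integral_eq_one]
    simp
  have h1 : μ {0} = ∫⁻ ξ, ({0} : Set (EuclideanSpace ℝ (Fin d))).indicator 1 ξ ∂μ := by
    rw [lintegral_indicator_one (measurableSet_singleton 0)]
  rw [h1]
  refine tendsto_lintegral_of_dominated_convergence
    (fun ξ => ‖𝓕⁻ (fun x => (u x : ℂ)) ξ‖ₑ ^ 2) (fun n => ?_)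
    (fun n => Eventually.of_forall fun ξ => ?_) ?_ (Eventually.of_forall fun ξ => ?_)
  · exact ((continuous_fourierInv ((continuous_smoothedIndicator hu (hB.measurableSet n)
      (hB.isBounded n)).integrable_of_hasCompactSupport
      (hasCompactSupport_smoothedIndicator hu (hB.isBounded n)))).enorm.measurable).pow_const 2
  · simp only
    rw [enorm_fourierInv_smoothedIndicator hu (hB.measurableSet n) (hB.isBounded n)]
    gcongr
    exact mul_le_of_le_one_right' (enorm_fourierInv_normalizedIndicator_le_one
      (hB.measurableSet n) (hB.isBounded n) (hB.volume_pos n) ξ)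
  · have := (hμ.integrable _ hu.continuous_ofReal hu.hasCompactSupport_ofReal).2
    rw [hasFiniteIntegral_iff_enorm] at this
    simpa [enorm_pow] using this.ne
  · simp_rw [fun n => enorm_fourierInv_smoothedIndicator hu (hB.measurableSet n) (hB.isBounded n) ξ]
    by_cases hξ : ξ = 0
    · subst hξ
      simp_rw [fun n => fourierInv_normalizedIndicator_zero (hB.measurableSet n) (hB.isBounded n)
        (hB.volume_pos n), hu0]
      simp
    · have h2 := ENNReal.Tendsto.pow (n := 2) (ENNReal.Tendsto.const_mul (a := ‖𝓕⁻ (fun x => (u x : ℂ)) ξ‖ₑ)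
        (tendsto_enorm_fourierInv_normalizedIndicator hB hξ) (Or.inr enorm_ne_top))
      simpa [hξ] using h2

end Density

/-! ### Smoothed sums as averages of point counts -/

section Counting

variable {d : ℕ} {A D Γ : Set (EuclideanSpace ℝ (Fin d))} {u : EuclideanSpace ℝ (Fin d) → ℝ}
  {S : Finset (EuclideanSpace ℝ (Fin d))}

lemma IsMollifier.lintegral_ofReal (hu : IsMollifier u 1) : ∫⁻ s, ENNReal.ofReal (u s) = 1 := by
  rw [← ofReal_integral_eq_lintegral_ofReal hu.integrable (Eventually.of_forall hu.nonneg),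
    hu.integral_eq_one, ENNReal.ofReal_one]

/-- All terms are nonnegative, so the modulus is the sum itself: an average over `s`, with weight
`u`, of the normalized number of points of `S` in `t + s + A`. -/
lemma enorm_sum_smoothedIndicator (hu : IsMollifier u 1) (hA : MeasurableSet A)
    (hb : Bornology.IsBounded A) (h0 : 0 < volume A) (S : Finset (EuclideanSpace ℝ (Fin d)))
    (t : EuclideanSpace ℝ (Fin d)) :
    ‖∑ x ∈ S, smoothedIndicator u A (x - t)‖ₑ =
      ∫⁻ s, ENNReal.ofReal (u s) * ∑ x ∈ S, A.indicator (fun _ => (volume A)⁻¹) (x - (t + s)) := by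
  obtain ⟨C, hC⟩ := hu.continuous.bounded_above_of_compact_support hu.hasCompactSupport
  have hi : ∀ x, Integrable fun s => (u s : ℂ) * normalizedIndicator A (x - t - s) := fun x =>
    ((integrable_normalizedIndicator hA hb).comp_sub_left (x - t)).bdd_mul (c := C)
      hu.continuous_ofReal.aestronglyMeasurable
      (Eventually.of_forall fun s => by simpa using hC s)
  let ρ : EuclideanSpace ℝ (Fin d) → ℝ := fun s =>
    u s * ∑ x ∈ S, A.indicator (fun _ => (volume.real A)⁻¹) (x - t - s)
  have hpos := volume_real_pos hb h0
  have hind : ∀ y, 0 ≤ A.indicator (fun _ => (volume.real A)⁻¹) y := fun y =>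
    Set.indicator_nonneg (fun _ _ => by positivity) y
  have hρ0 : ∀ s, 0 ≤ ρ s := fun s =>
    mul_nonneg (hu.nonneg s) (Finset.sum_nonneg fun x _ => hind _)
  have hρ : ∀ s, ∑ x ∈ S, (u s : ℂ) * normalizedIndicator A (x - t - s) = (ρ s : ℂ) := by
    intro s
    rw [← Finset.mul_sum]
    push_cast [ρ]
    congr 1
    refine Finset.sum_congr rfl fun x _ => ?_
    by_cases hx : x - t - s ∈ A
    · simp only [normalizedIndicator, Set.indicator_of_mem hx]
    · simp only [normalizedIndicator, Set.indicator_of_notMem hx, Complex.ofReal_zero]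
  have hρi : Integrable ρ := by
    have := integrable_finsetSum S fun x _ => hi x
    simp_rw [hρ] at this
    simpa using this.re
  have h1 : ∑ x ∈ S, smoothedIndicator u A (x - t) = ((∫ s, ρ s : ℝ) : ℂ) := by
    simp only [smoothedIndicator, convolution_def, ContinuousLinearMap.mul_apply']
    rw [← integral_finsetSum S fun x _ => hi x, ← integral_complex_ofReal]
    simp_rw [hρ]
  rw [h1, ← ofReal_norm, Complex.norm_real, Real.norm_of_nonneg (integral_nonneg hρ0),
    ofReal_integral_eq_lintegral_ofReal hρi (Eventually.of_forall hρ0)]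
  congr 1
  ext s
  rw [ENNReal.ofReal_mul (hu.nonneg s), ENNReal.ofReal_sum_of_nonneg fun x _ => hind _]
  congr 1
  refine Finset.sum_congr rfl fun x _ => ?_
  rw [sub_sub]
  by_cases hx : x - (t + s) ∈ A
  · simp only [Set.indicator_of_mem hx]
    rw [ENNReal.ofReal_inv_of_pos hpos, Measure.real, ENNReal.ofReal_toReal hb.measure_lt_top.ne]
  · simp only [Set.indicator_of_notMem hx, ENNReal.ofReal_zero]

lemma sum_indicator_sub (S : Finset (EuclideanSpace ℝ (Fin d)))
    (A : Set (EuclideanSpace ℝ (Fin d))) (c : ℝ≥0∞) (z : EuclideanSpace ℝ (Fin d)) :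
    ∑ x ∈ S, A.indicator (fun _ => c) (x - z) =
      (((S : Set (EuclideanSpace ℝ (Fin d))) ∩ (z +ᵥ A)).encard : ℝ≥0∞) * c := by
  classical
  have hmem : ∀ x, x ∈ z +ᵥ A ↔ x - z ∈ A := fun x => by
    rw [Set.mem_vadd_set_iff_neg_vadd_mem, vadd_eq_add, neg_add_eq_sub]
  have h1 : (S : Set (EuclideanSpace ℝ (Fin d))) ∩ (z +ᵥ A) =
      (S.filter fun x => x - z ∈ A : Finset _) := by
    ext x
    simp [hmem]
  rw [h1, Set.encard_coe_eq_coe_finsetCard, ENat.toENNReal_coe, ← nsmul_eq_mul,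
    ← Finset.sum_const, Finset.sum_filter]
  simp [Set.indicator_apply]

lemma enorm_sum_smoothedIndicator_le (hu : IsMollifier u 1) (hA : MeasurableSet A)
    (hb : Bornology.IsBounded A) (h0 : 0 < volume A) (hS : ∀ x ∈ S, x ∈ Γ)
    (t : EuclideanSpace ℝ (Fin d)) :
    ‖∑ x ∈ S, smoothedIndicator u A (x - t)‖ₑ ≤
      ⨆ x : EuclideanSpace ℝ (Fin d), ((Γ ∩ (x +ᵥ A)).encard : ℝ≥0∞) / volume A := by
  rw [enorm_sum_smoothedIndicator hu hA hb h0]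
  calc _ ≤ ∫⁻ s, ENNReal.ofReal (u s) *
        ⨆ x : EuclideanSpace ℝ (Fin d), ((Γ ∩ (x +ᵥ A)).encard : ℝ≥0∞) / volume A := by
        refine lintegral_mono fun s => ?_
        gcongr
        rw [sum_indicator_sub, ← div_eq_mul_inv]
        refine le_trans ?_ (le_iSup _ (t + s))
        gcongr
        exact hS
    _ = _ := by
        rw [lintegral_mul_const _ (by have := hu.continuous.measurable; fun_prop),
          hu.lintegral_ofReal, one_mul]

/-- The hypothesis `hS` says that near `t` the finite set `S` misses no point of `Γ` seen by the
window `A`; this holds when `t` is far from the complement of the region that cuts out `S`. -/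
lemma le_enorm_sum_smoothedIndicator (hu : IsMollifier u 1) (hA : MeasurableSet A)
    (hb : Bornology.IsBounded A) (h0 : 0 < volume A) {t : EuclideanSpace ℝ (Fin d)}
    (hS : ∀ s, ‖s‖ < 1 → ∀ x ∈ Γ, x - (t + s) ∈ A → x ∈ S) :
    ⨅ x : EuclideanSpace ℝ (Fin d), ((Γ ∩ (x +ᵥ A)).encard : ℝ≥0∞) / volume A ≤
      ‖∑ x ∈ S, smoothedIndicator u A (x - t)‖ₑ := by
  rw [enorm_sum_smoothedIndicator hu hA hb h0]
  calc _ = ∫⁻ s, ENNReal.ofReal (u s) *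
        ⨅ x : EuclideanSpace ℝ (Fin d), ((Γ ∩ (x +ᵥ A)).encard : ℝ≥0∞) / volume A := by
        rw [lintegral_mul_const _ (by have := hu.continuous.measurable; fun_prop),
          hu.lintegral_ofReal, one_mul]
    _ ≤ _ := by
        refine lintegral_mono fun s => ?_
        by_cases hs : ‖s‖ < 1
        · gcongr
          rw [sum_indicator_sub, ← div_eq_mul_inv]
          refine (iInf_le _ (t + s)).trans ?_
          refine ENNReal.div_le_div_right (ENat.toENNReal_le.2 (Set.encard_le_encard ?_)) _
          rintro x ⟨hx, hxA⟩
          refine ⟨hS s hs x hx ?_, hxA⟩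
          rwa [Set.mem_vadd_set_iff_neg_vadd_mem, vadd_eq_add, neg_add_eq_sub] at hxA
        · simp [hu.eq_zero s (not_lt.1 hs)]

lemma enorm_sum_smoothedIndicator_eq_zero (hu : IsMollifier u 1) (hA : MeasurableSet A)
    (hb : Bornology.IsBounded A) (h0 : 0 < volume A) {t : EuclideanSpace ℝ (Fin d)}
    (hS : ∀ s, ‖s‖ < 1 → ∀ x ∈ S, x - (t + s) ∉ A) :
    ‖∑ x ∈ S, smoothedIndicator u A (x - t)‖ₑ = 0 := by
  rw [enorm_sum_smoothedIndicator hu hA hb h0]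
  refine (lintegral_congr fun s => ?_).trans lintegral_zero
  by_cases hs : ‖s‖ < 1
  · rw [Finset.sum_eq_zero fun x hx => Set.indicator_of_notMem (hS s hs x hx) _, mul_zero]
  · simp [hu.eq_zero s (not_lt.1 hs)]

variable {r : ℝ}

/-- If the sum is nonzero at `t`, then `t` is within `r + 1` of a point of `D`: `r` for the window
`A` and `1` for the support of `u`. So `t` lies in `D` or in its boundary. -/
lemma lintegral_sum_smoothedIndicator_le (hu : IsMollifier u 1) (hA : MeasurableSet A)
    (hb : Bornology.IsBounded A) (h0 : 0 < volume A) (hr : A ⊆ Metric.closedBall 0 r)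
    (hS : ∀ x, x ∈ S ↔ x ∈ Γ ∩ D) :
    ∫⁻ t, ‖∑ x ∈ S, smoothedIndicator u A (x - t)‖ₑ ^ 2 ≤
      (⨆ x : EuclideanSpace ℝ (Fin d), ((Γ ∩ (x +ᵥ A)).encard : ℝ≥0∞) / volume A) ^ 2 *
        (volume D + volume (vanHoveBoundary (Metric.closedBall 0 (r + 1)) D)) := by
  set K : Set (EuclideanSpace ℝ (Fin d)) := Metric.closedBall 0 (r + 1) with hK
  set M := ⨆ x : EuclideanSpace ℝ (Fin d), ((Γ ∩ (x +ᵥ A)).encard : ℝ≥0∞) / volume A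
  calc _ ≤ ∫⁻ t, (D ∪ vanHoveBoundary K D).indicator (fun _ => M ^ 2) t := by
        refine lintegral_mono fun t => ?_
        by_cases ht : t ∈ D ∪ vanHoveBoundary K D
        · rw [Set.indicator_of_mem ht]
          gcongr
          exact enorm_sum_smoothedIndicator_le hu hA hb h0 (fun x hx => ((hS x).1 hx).1) t
        · rw [Set.indicator_of_notMem ht, enorm_sum_smoothedIndicator_eq_zero hu hA hb h0, zero_pow
            two_ne_zero]
          intro s hs x hx hxA
          refine ht (Or.inr (Or.inl ⟨Set.mem_add.2 ⟨x, ((hS x).1 hx).2, t - x, ?_, by abel⟩,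
            fun h => ht (Or.inl (interior_subset h))⟩))
          have h1 := mem_closedBall_zero_iff.1 (hr hxA)
          rw [hK, mem_closedBall_zero_iff]
          calc ‖t - x‖ = ‖(x - (t + s)) + s‖ := by rw [← norm_neg]; congr 1; abel
            _ ≤ _ := (norm_add_le _ _).trans (add_le_add h1 hs.le)
    _ ≤ M ^ 2 * volume (D ∪ vanHoveBoundary K D) := lintegral_indicator_const_le _ _
    _ ≤ _ := by
        gcongr
        exact measure_union_le _ _

lemma le_lintegral_sum_smoothedIndicator (hu : IsMollifier u 1) (hA : MeasurableSet A)
    (hb : Bornology.IsBounded A) (h0 : 0 < volume A) (hr : A ⊆ Metric.closedBall 0 r)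
    (hD : MeasurableSet D) (hS : ∀ x, x ∈ S ↔ x ∈ Γ ∩ D) :
    (⨅ x : EuclideanSpace ℝ (Fin d), ((Γ ∩ (x +ᵥ A)).encard : ℝ≥0∞) / volume A) ^ 2 *
        (volume D - volume (vanHoveBoundary (Metric.closedBall 0 (r + 1)) D)) ≤
      ∫⁻ t, ‖∑ x ∈ S, smoothedIndicator u A (x - t)‖ₑ ^ 2 := by
  set K : Set (EuclideanSpace ℝ (Fin d)) := Metric.closedBall 0 (r + 1) with hK
  set m := ⨅ x : EuclideanSpace ℝ (Fin d), ((Γ ∩ (x +ᵥ A)).encard : ℝ≥0∞) / volume A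
  -- Removing a measurable hull of the boundary, of the same volume, keeps `T` measurable. For `t ∈
  -- T` every point within `r + 1` belongs to `D`.
  set T := D \ toMeasurable volume (vanHoveBoundary K D) with hT
  have hTm : MeasurableSet T := hD.diff (measurableSet_toMeasurable _ _)
  calc m ^ 2 * (volume D - volume (vanHoveBoundary K D)) ≤ m ^ 2 * volume T := by
        gcongr
        rw [← measure_toMeasurable (vanHoveBoundary K D)]
        exact le_measure_sdiff
    _ = ∫⁻ t, T.indicator (fun _ => m ^ 2) t := (lintegral_indicator_const hTm _).symm
    _ ≤ _ := by
        refine lintegral_mono fun t => ?_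
        by_cases ht : t ∈ T
        · rw [Set.indicator_of_mem ht]
          gcongr
          refine le_enorm_sum_smoothedIndicator hu hA hb h0 fun s hs x hx hxA => ?_
          by_contra hxS
          have hxD : x ∈ Dᶜ := fun h => hxS ((hS x).2 ⟨hx, h⟩)
          refine ht.2 (subset_toMeasurable _ _ (Or.inr
            ⟨Set.mem_sub.2 ⟨x, subset_closure hxD, x - t, ?_, by abel⟩, ht.1⟩))
          have h1 := mem_closedBall_zero_iff.1 (hr hxA)
          rw [hK, mem_closedBall_zero_iff]
          calc ‖x - t‖ = ‖(x - (t + s)) + s‖ := by congr 1; abel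
            _ ≤ _ := (norm_add_le _ _).trans (add_le_add h1 hs.le)
        · rw [Set.indicator_of_notMem ht]
          exact zero_le

end Counting

/-! ### Density bounds at a fixed scale and the conclusion -/

lemma integrable_norm_sq_of_hasCompactSupport {X : Type*} [TopologicalSpace X] [MeasurableSpace X]
    [OpensMeasurableSpace X] {μ : Measure X} [IsFiniteMeasureOnCompacts μ] {g : X → ℂ}
    (hg : Continuous g) (hc : HasCompactSupport g) : Integrable (fun t => ‖g t‖ ^ 2) μ := by
  have h1 : Continuous fun t => ‖g t‖ ^ 2 := hg.norm.pow 2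
  have h2 : HasCompactSupport fun t => ‖g t‖ ^ 2 :=
    HasCompactSupport.intro' hc (isClosed_tsupport g) fun x hx => by
      simp [image_eq_zero_of_notMem_tsupport hx]
  exact h1.integrable_of_hasCompactSupport h2

lemma enorm_integral_norm_sq {X : Type*} [MeasurableSpace X] {μ : Measure X} {g : X → ℂ}
    (hg : Integrable (fun t => ‖g t‖ ^ 2) μ) :
    ‖((∫ t, ‖g t‖ ^ 2 ∂μ : ℝ) : ℂ)‖ₑ = ∫⁻ t, ‖g t‖ₑ ^ 2 ∂μ := by
  rw [← ofReal_norm, Complex.norm_real,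
    Real.norm_of_nonneg (integral_nonneg fun _ => by positivity),
    ofReal_integral_eq_lintegral_ofReal hg (Eventually.of_forall fun _ => by positivity)]
  simp_rw [ENNReal.ofReal_pow (norm_nonneg _), ofReal_norm]

/-- Two scales are at play: the window `B k` is fixed while the averaging region `B n` grows, so the
boundary of `B n` at the width of the window is negligible and the bounds become exact in the limit.
-/
lemma lintegral_fourierInv_smoothedIndicator_bounds {d : ℕ}
    {Γ : Set (EuclideanSpace ℝ (Fin d))}
    {B : ℕ → Set (EuclideanSpace ℝ (Fin d))} (hB : IsVanHove B)
    (hfin : ∀ n, (Γ ∩ B n).Finite) {γ γhat : Measure (EuclideanSpace ℝ (Fin d))}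
    (hγ : IsAutocorrelation (diracComb Γ) B γ) (hhat : IsFourierTransform γ γhat)
    {u : EuclideanSpace ℝ (Fin d) → ℝ} (hu : IsMollifier u 1) (k : ℕ) :
    (⨅ x : EuclideanSpace ℝ (Fin d), ((Γ ∩ (x +ᵥ B k)).encard : ℝ≥0∞) / volume (B k)) ^ 2 ≤
        ∫⁻ ξ, ‖𝓕⁻ (smoothedIndicator u (B k)) ξ‖ₑ ^ 2 ∂γhat ∧
      ∫⁻ ξ, ‖𝓕⁻ (smoothedIndicator u (B k)) ξ‖ₑ ^ 2 ∂γhat ≤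
        (⨆ x : EuclideanSpace ℝ (Fin d), ((Γ ∩ (x +ᵥ B k)).encard : ℝ≥0∞) / volume (B k)) ^ 2 := by
  have hA := hB.measurableSet k
  have hb := hB.isBounded k
  have h0 := hB.volume_pos k
  set A := B k with hAdef
  set f := smoothedIndicator u A with hfdef
  have hf : Continuous f := continuous_smoothedIndicator hu hA hb
  have hc : HasCompactSupport f := hasCompactSupport_smoothedIndicator hu hb
  obtain ⟨r, hr⟩ := hb.subset_closedBall 0
  set K : Set (EuclideanSpace ℝ (Fin d)) := Metric.closedBall 0 (r + 1)
  have hvol : ∀ n, volume (B n) ≠ ⊤ := fun n => (hB.isBounded n).measure_lt_top.ne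
  have hvol0 : ∀ n, volume (B n) ≠ 0 := fun n => (hB.volume_pos n).ne'
  have hlim : Tendsto (fun n => (volume (B n))⁻¹ *
      ∫⁻ t, ‖∑ x ∈ (hfin n).toFinset, f (x - t)‖ₑ ^ 2) atTop
      (𝓝 (∫⁻ ξ, ‖𝓕⁻ f ξ‖ₑ ^ 2 ∂γhat)) := by
    have h1 := (hγ.tendsto_integral _ (continuous_selfCorr hf hc)
      (hasCompactSupport_selfCorr hc)).enorm
    rw [hhat.integral_selfCorr hf hc] at h1
    rw [enorm_integral_norm_sq (hhat.integrable f hf hc)] at h1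
    refine h1.congr fun n => ?_
    have hS := continuous_sum_comp_sub hf (hfin n).toFinset
    have hSc := hasCompactSupport_sum_comp_sub hc (hfin n).toFinset
    rw [integral_autocorrApprox_diracComb (hB.measurableSet n) fun x => (hfin n).mem_toFinset,
      sum_selfCorr_sub hf hc, enorm_mul,
      enorm_integral_norm_sq (integrable_norm_sq_of_hasCompactSupport hS hSc)]
    congr 1
    rw [← ofReal_norm, Complex.norm_real, Real.norm_of_nonneg (by positivity),
      ENNReal.ofReal_inv_of_pos (volume_real_pos (hB.isBounded n) (hB.volume_pos n)),
      Measure.real, ENNReal.ofReal_toReal (hvol n)]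
  have hbd := hB.tendsto_boundary K (isCompact_closedBall 0 (r + 1))
  constructor
  · have h3 : Tendsto (fun n => (⨅ x : EuclideanSpace ℝ (Fin d),
        ((Γ ∩ (x +ᵥ A)).encard : ℝ≥0∞) / volume A) ^ 2 *
        (1 - volume (vanHoveBoundary K (B n)) / volume (B n))) atTop
        (𝓝 ((⨅ x : EuclideanSpace ℝ (Fin d),
        ((Γ ∩ (x +ᵥ A)).encard : ℝ≥0∞) / volume A) ^ 2 * (1 - 0))) :=
      ENNReal.Tendsto.const_mul (ENNReal.Tendsto.sub tendsto_const_nhds hbd (Or.inl (by simp)))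
        (Or.inl (by simp))
    rw [tsub_zero, mul_one] at h3
    refine le_of_tendsto_of_tendsto' h3 hlim fun n => ?_
    have h4 := le_lintegral_sum_smoothedIndicator hu hA hb h0 hr (hB.measurableSet n)
      fun x => (hfin n).mem_toFinset
    refine le_trans (le_of_eq ?_) (mul_le_mul_right h4 (volume (B n))⁻¹)
    rw [mul_left_comm, ENNReal.mul_sub fun _ _ => ENNReal.inv_ne_top.2 (hvol0 n),
      ENNReal.inv_mul_cancel (hvol0 n) (hvol n), div_eq_mul_inv,
          mul_comm (volume (vanHoveBoundary _ _))]
  · have h3 : Tendsto (fun n => (⨆ x : EuclideanSpace ℝ (Fin d),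
        ((Γ ∩ (x +ᵥ A)).encard : ℝ≥0∞) / volume A) ^ 2 *
        (1 + volume (vanHoveBoundary K (B n)) / volume (B n))) atTop
        (𝓝 ((⨆ x : EuclideanSpace ℝ (Fin d),
        ((Γ ∩ (x +ᵥ A)).encard : ℝ≥0∞) / volume A) ^ 2 * (1 + 0))) :=
      ENNReal.Tendsto.const_mul (tendsto_const_nhds.add hbd) (Or.inl (by simp))
    rw [add_zero, mul_one] at h3
    refine le_of_tendsto_of_tendsto' hlim h3 fun n => ?_
    have h4 := lintegral_sum_smoothedIndicator_le hu hA hb h0 hr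
      fun x => (hfin n).mem_toFinset
    refine (mul_le_mul_right h4 (volume (B n))⁻¹).trans (le_of_eq ?_)
    rw [mul_left_comm, mul_add, ENNReal.inv_mul_cancel (hvol0 n) (hvol n), div_eq_mul_inv,
      mul_comm (volume (vanHoveBoundary _ _))]

theorem lemma8p6 {d : ℕ} (Γ : Delone.DeloneSet (EuclideanSpace ℝ (Fin d)))
    (B : ℕ → Set (EuclideanSpace ℝ (Fin d))) (hB : IsVanHove B)
    (γ : Measure (EuclideanSpace ℝ (Fin d)))
    (hγ : IsAutocorrelation (diracComb Γ.carrier) B γ) :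
    (∃ γhat : Measure (EuclideanSpace ℝ (Fin d)), IsFourierTransform γ γhat) ∧
    ∀ γhat : Measure (EuclideanSpace ℝ (Fin d)), IsFourierTransform γ γhat →
      lowerDensity Γ.carrier B ^ 2 ≤ γhat {0} ∧ γhat {0} ≤ upperDensity Γ.carrier B ^ 2 := by
  have hfin : ∀ n, (Γ.carrier ∩ B n).Finite := fun n => deloneSet_inter_finite Γ (hB.isBounded n)
  refine ⟨?_, fun γhat hhat => ?_⟩
  · choose μ hμ using fun n => isFourierTransform_autocorrApprox (hB.measurableSet n) (hfin n)
    have := fun n => isFiniteMeasure_autocorrApprox (hB.measurableSet n) (hB.volume_pos n) (hfin n)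
    exact exists_isFourierTransform_of_tendsto hμ hγ.tendsto_integral
  · obtain ⟨u, hu⟩ := exists_isMollifier (EuclideanSpace ℝ (Fin d)) one_pos
    have hlim := tendsto_lintegral_fourierInv_smoothedIndicator hhat hu hB
    have hbd := lintegral_fourierInv_smoothedIndicator_bounds hB hfin hγ hhat hu
    have hmono : Monotone fun x : ℝ≥0∞ => x ^ 2 := fun a b h => pow_le_pow_left' h 2
    have hcont : Continuous fun x : ℝ≥0∞ => x ^ 2 := ENNReal.continuous_pow 2
    constructor
    -- Squaring is monotone and continuous on `ℝ≥0∞`, so it commutes with `liminf`, and below with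
    -- `limsup`.
    · rw [← hlim.liminf_eq, lowerDensity]
      refine (hmono.map_liminf_of_continuousAt _ hcont.continuousAt).trans_le ?_
      exact liminf_le_liminf (Eventually.of_forall fun k => (hbd k).1)
    · rw [← hlim.limsup_eq, upperDensity]
      refine le_trans ?_ (hmono.map_limsup_of_continuousAt _ hcont.continuousAt).ge
      exact limsup_le_limsup (Eventually.of_forall fun k => (hbd k).2)
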